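/- **The model.** There are $n$ nodes with identifiers $1,\dots,n$, joined by an undirected connected weighted graph $G=(V,E,w)$ with $w:E\to\{1,\dots,W\}$ (the local edges), and any two nodes are also joined by a global edge. Initially each node knows $n$, its identifier, its incident local edges with their weights, and an independent private random seed. Computation proceeds in synchronous rounds, and local computation is unrestricted. In each round a node can send a message of arbitrary size over each of its local edges, and in addition at most $\gamma$ messages of $B$ bits each over global edges, to recipients of its choice. All local messages are delivered. If at most $\gamma$ global messages are addressed to a node in a round, all of them are delivered; otherwise an adversary chooses which of them, at most $\gamma$, are delivered. For $u,v\in V$, $d(u,v)$ denotes the minimum of $\sum_{e\in P}w(e)$ over all $u$-$v$-paths $P$ in $G$. In the all-pairs shortest paths problem (APSP), every node $u$ has to learn $d(u,v)$ for all $v\in V$. **Theorem 2.2.** In this model, with $\gamma=\Theta(\log n)$, $B=O(\log n)$ and $W$ polynomially bounded in $n$, APSP can be solved exactly in $\tilde O(n^{2/3})$ rounds with high probability. Precisely: there is a constant $p\in\mathbb N$ such that for every $a\in\mathbb N$ there is a $\beta\in\mathbb N$ such that for all real $g>0$ and $c>0$ there are $C\in\mathbb R$ and $n_0\in\mathbb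 N$ for which the following holds. For every $n\ge n_0$ there are a randomized algorithm for the model with $\gamma=\lceil g\log n\rceil$ and $B=\beta\lceil\log_2 n\rceil$, and a number of rounds $T\le C\,n^{2/3}(\log n)^p$, such that on every connected graph $G$ on $n$ nodes with edge weights in $\{1,\dots,n^a\}$, with probability at least $1-n^{-c}$ over the private seeds, whatever the adversary does, after $T$ rounds every node $u$ outputs $d(u,v)$ for all $v\in V$. -/

import Mathlib

/-- Length of a walk: the sum of the weights of its edges. -/
def walkWeight {V : Type} {G : SimpleGraph V} (w : Sym2 V → ℕ) {u v : V} (P : G.Walk u v) : ℕ :=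
  (P.edges.map w).sum

/-- Weighted distance `d_G(u,v)`: the smallest length of a `u`-`v`-path (`⊤` if there is none).
Only the values of `w` on edges of `G` matter. -/
noncomputable def weightedDist {V : Type} (G : SimpleGraph V) (w : Sym2 V → ℕ) (u v : V) : ℕ∞ :=
  ⨅ P : G.Path u v, (walkWeight w P.1 : ℕ∞)

/-- A randomized synchronous algorithm for the hybrid network model on the nodes (identifiers)
`Fin n`, with unbounded local capacity, global capacity `γ` (messages per node and round), and
global messages of `B` bits. Local computation is unrestricted. -/
structure HybridAlgorithm (n γ B : ℕ) where
  /-- Private randomness: every node gets an independent uniform element of this finite type. -/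
  Seed : Type
  seedFintype : Fintype Seed
  seedNonempty : Nonempty Seed
  /-- Internal states of a node. -/
  State : Type
  /-- Contents of what is sent over one local edge in one round; arbitrary, since local edges are
  uncapacitated. -/
  LocalMsg : Type
  /-- Initial state, from the identifier of the node, its incident edges with their weights
  (`none` means that there is no edge to that node), and its private seed. -/
  start : Fin n → (Fin n → Option ℕ) → Seed → State
  /-- What a node in a given state sends over its local edge to the given neighbour. -/
  sendLocal : State → Fin n → LocalMsg
  /-- The at most `γ` messages that a node sends over global edges, with their recipients. -/
  sendGlobal : State → Fin γ → Option (Fin n × (Fin B → Bool))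
  /-- New state, from the old one, the messages received over local edges (`none` from nodes that
  are not neighbours) and the unordered collection of messages received over global edges. A global
  message carries its contents only; a sender who wants to be known writes its identifier into
  the message. -/
  step : State → (Fin n → Option LocalMsg) → Multiset (Fin B → Bool) → State
  /-- The distance estimates from this node to all nodes. -/
  output : State → Fin n → ℕ

namespace HybridAlgorithm

variable {n γ B : ℕ} (A : HybridAlgorithm n γ B)

open Classical in
/-- The initial knowledge of a node: its incident edges and their weights. -/
noncomputable def localView (G : SimpleGraph (Fin n)) (w : Sym2 (Fin n) → ℕ) (u : Fin n) :
    Fin n → Option ℕ :=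
  fun v => if G.Adj u v then some (w s(u, v)) else none

open Classical in
/-- What `u` receives over local edges when `σ` is the current configuration: everything that is
sent to it. -/
noncomputable def localInbox (G : SimpleGraph (Fin n)) (σ : Fin n → A.State) (u : Fin n) :
    Fin n → Option A.LocalMsg :=
  fun v => if G.Adj u v then some (A.sendLocal (σ v) u) else none

open Classical in
/-- The global messages addressed to `u`, each named by its sender and its position in the list of
messages of that sender. -/
noncomputable def addressedTo (σ : Fin n → A.State) (u : Fin n) : Finset (Fin n × Fin γ) :=
  Finset.univ.filter fun q => ∃ m, A.sendGlobal (σ q.1) q.2 = some (u, m)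

/-- The contents of a set of global messages. -/
def contents (σ : Fin n → A.State) (D : Finset (Fin n × Fin γ)) : Multiset (Fin B → Bool) :=
  D.val.filterMap fun q => (A.sendGlobal (σ q.1) q.2).map Prod.snd

/-- `D` may be delivered to a node to which the global messages `S` are addressed: all of `S` if
there are at most `γ` of them, and otherwise an arbitrary selection that respects the capacity. -/
def Deliverable (S D : Finset (Fin n × Fin γ)) : Prop :=
  D ⊆ S ∧ D.card ≤ γ ∧ (S.card ≤ γ → D = S)

/-- `σ t u` is the state of node `u` after `t` rounds in some execution on the graph `(G, w)` with
seeds `r`. The deliveries at overloaded nodes are arbitrary: they are chosen by an adversary who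
knows everything, including all the seeds. -/
def IsExecution (G : SimpleGraph (Fin n)) (w : Sym2 (Fin n) → ℕ) (r : Fin n → A.Seed)
    (σ : ℕ → Fin n → A.State) : Prop :=
  (∀ u, σ 0 u = A.start u (localView G w u) (r u)) ∧
  ∀ t u, ∃ D, Deliverable (A.addressedTo (σ t) u) D ∧
    σ (t + 1) u = A.step (σ t u) (A.localInbox G (σ t) u) (A.contents (σ t) D)

/-- With seeds `r`, whatever the adversary does, after `T` rounds every node knows its exact
distance to every node. -/
def SolvesAPSPWithSeeds (T : ℕ) (G : SimpleGraph (Fin n)) (w : Sym2 (Fin n) → ℕ)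
    (r : Fin n → A.Seed) : Prop :=
  ∀ σ, A.IsExecution G w r σ → ∀ u v, (A.output (σ T u) v : ℕ∞) = weightedDist G w u v

/-- Probability of an event over independent, uniformly distributed private seeds. -/
noncomputable def seedProb (E : Set (Fin n → A.Seed)) : ℝ :=
  (E.ncard : ℝ) / (Nat.card (Fin n → A.Seed) : ℝ)

end HybridAlgorithm

/-! Put h ≈ n^(2/3), q = h + 1, and call the least weight of a walk with at most h edges a
hop-limited distance. Flooding the local edges for O(h) rounds tells a node everything within O(h)
hops, in particular its hop-limited distances. Longer lightest walks are cut at hitters: a set of K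
≈ n^(1/3) log n nodes that meets every critical set. Each nonempty critical set has at least h
members, so greedy choice finds such a set, and every exact distance from u is then a sum of
hop-limited distances whose legs start at u or at a hitter (`exists_route`). Hence it suffices that
every node u learns the hop-limited distances between all nodes and all hitters. For this, M ≈
n^(1/3) centers are chosen greedily, more than 2h hops apart, so that their h-balls are disjoint and
every node is within 2h hops of a center. A ball has at least q members. The member of rank i < q is
responsible for the nodes congruent to i modulo q, and every node sends its K distances to the
responsible member of each ball. Then each report is held within 3h hops of every node, and one more
flood finishes. Introducing the members to the senders takes M² rounds and the reports take M·K
rounds. The greedy choices are maximizations over all nodes, which cost logarithmically many rounds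
each by doubling. Every node sends at most one global message per round, and no two of these have
the same recipient. As γ ≥ 1, everything is delivered: the adversary has no choice, no randomness is
needed, and the success probability is 1. -/

/-! ### Full-information executions -/

/-- A connected network on `Fin n` whose edge weights are at most `W`. -/
structure Network (n W : ℕ) where
  graph : SimpleGraph (Fin n)
  weight : Sym2 (Fin n) → ℕ
  connected : graph.Connected
  weight_le : ∀ e ∈ graph.edgeSet, weight e ≤ W

/-- Full-information states: a node remembers its initial knowledge and everything it receives, and
sends its whole state over its local edges. -/
inductive Info (n B : ℕ) : Type
  | start : Fin n → (Fin n → Option ℕ) → Info n B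
  | step : Info n B → (Fin n → Option (Info n B)) → Multiset (Fin B → Bool) → Info n B

namespace Info

variable {n B : ℕ}

/-- The number of rounds that have passed. -/
def time : Info n B → ℕ
  | start _ _ => 0
  | step i _ _ => i.time + 1

/-- The identifier of the node. -/
def ident : Info n B → Fin n
  | start u _ => u
  | step i _ _ => i.ident

end Info

/-- The deterministic full-information algorithm in which a node sends at most one global message
per round. -/
def fullInfo {n : ℕ} (γ : ℕ) {B : ℕ} (send : Info n B → Option (Fin n × (Fin B → Bool)))
    (out : Info n B → Fin n → ℕ) : HybridAlgorithm n γ B where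
  Seed := Unit
  seedFintype := inferInstance
  seedNonempty := inferInstance
  State := Info n B
  LocalMsg := Info n B
  start u view _ := .start u view
  sendLocal s _ := s
  sendGlobal s i := if i.val = 0 then send s else none
  step := .step
  output := out

/-! ### What nodes can learn: flooding, schedules and maximizations -/

section Learns

variable {n W γ B : ℕ}

open Classical in
/-- `σ` follows the rules of the full-information algorithm during the first `T` rounds. -/
def IsRun (γ : ℕ) (send : Info n B → Option (Fin n × (Fin B → Bool))) (N : Network n W) (T : ℕ)
    (σ : ℕ → Fin n → Info n B) : Prop :=
  (∀ u, σ 0 u = .start u (HybridAlgorithm.localView N.graph N.weight u)) ∧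
  ∀ t < T, ∀ u, ∃ D,
    HybridAlgorithm.Deliverable ((fullInfo γ send fun _ _ => 0).addressedTo (σ t) u) D ∧
    σ (t + 1) u = .step (σ t u) (fun v => if N.graph.Adj u v then some (σ t v) else none)
      ((fullInfo γ send fun _ _ => 0).contents (σ t) D)

/-- After `T` rounds of a suitable algorithm, on every network `N` and whatever the adversary does,
every node `u` knows `f N u`. -/
def Learns {X : Type} (γ B T : ℕ) (f : Network n W → Fin n → X) : Prop :=
  ∃ (send : Info n B → Option (Fin n × (Fin B → Bool))) (read : Info n B → X),
    ∀ N σ, IsRun γ send N T σ → ∀ u, read (σ T u) = f N u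

open Classical in
/-- The number that `u` receives when every node `v` sends `s v`. -/
noncomputable def received (s : Fin n → Option (Fin n × ℕ)) (u : Fin n) : Option ℕ :=
  if h : ∃ m v, s v = some (u, m) then some h.choose else none

/-- No two nodes send a global message to the same node. -/
def CollisionFree (s : Fin n → Option (Fin n × ℕ)) : Prop :=
  ∀ u v v' m m', s v = some (u, m) → s v' = some (u, m') → v = v'

theorem received_eq_some {s : Fin n → Option (Fin n × ℕ)} (hs : CollisionFree s) {u : Fin n}
    {m : ℕ} : received s u = some m ↔ ∃ v, s v = some (u, m) := by
  classical
  constructor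
  · intro h
    unfold received at h
    split_ifs at h with h'
    obtain rfl := Option.some.inj h
    exact h'.choose_spec
  · rintro ⟨v, hv⟩
    have h' : ∃ m v, s v = some (u, m) := ⟨m, v, hv⟩
    obtain ⟨v', hv'⟩ := h'.choose_spec
    obtain rfl := hs u v v' _ _ hv hv'
    unfold received
    rw [dif_pos h']
    rw [hv] at hv'
    simp only [Option.some.injEq, Prod.mk.injEq, true_and] at hv'
    rw [← hv']

/-- Numbers below `2 ^ B` as global messages. -/
noncomputable def bitsEquiv (B : ℕ) : (Fin B → Bool) ≃ Fin (2 ^ B) :=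
  Fintype.equivFinOfCardEq (by simp)

/-- The message that represents `m` (if `m < 2 ^ B`). -/
noncomputable def toBits (B m : ℕ) : Fin B → Bool :=
  (bitsEquiv B).symm ⟨m % 2 ^ B, Nat.mod_lt _ (by positivity)⟩

theorem bitsEquiv_toBits {m : ℕ} (h : m < 2 ^ B) : (bitsEquiv B (toBits B m) : ℕ) = m := by
  simp [toBits, Nat.mod_eq_of_lt h]

theorem mem_addressedTo {send : Info n B → Option (Fin n × (Fin B → Bool))} {σ : Fin n → Info n B}
    {u : Fin n} {q : Fin n × Fin γ} :
    q ∈ (fullInfo γ send fun _ _ => 0).addressedTo σ u ↔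
      q.2.val = 0 ∧ ∃ m, send (σ q.1) = some (u, m) := by
  unfold HybridAlgorithm.addressedTo
  rw [Finset.mem_filter]
  by_cases h0 : q.2.val = 0 <;> simp [fullInfo, h0]

theorem IsRun.mono {send : Info n B → Option (Fin n × (Fin B → Bool))} {N : Network n W}
    {T T' : ℕ} {σ : ℕ → Fin n → Info n B} (h : IsRun γ send N T σ) (hT : T' ≤ T) :
    IsRun γ send N T' σ :=
  ⟨h.1, fun t ht => h.2 t (ht.trans_le hT)⟩

theorem IsRun.time_eq {send : Info n B → Option (Fin n × (Fin B → Bool))} {N : Network n W}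
    {T : ℕ} {σ : ℕ → Fin n → Info n B} (h : IsRun γ send N T σ) :
    ∀ t ≤ T, ∀ u, (σ t u).time = t ∧ (σ t u).ident = u := by
  intro t
  induction t with
  | zero => intro _ u; rw [h.1 u]; exact ⟨rfl, rfl⟩
  | succ t ih =>
    intro ht u
    obtain ⟨D, -, hD⟩ := h.2 t ht u
    rw [hD]
    exact ⟨congrArg (· + 1) (ih (by omega) u).1, (ih (by omega) u).2⟩

/-- A state records its age, so changing the sending rule only from time `T` on leaves the first `T`
rounds intact. This is what permits algorithms to be run one after the other. -/
theorem IsRun.congr {send send' : Info n B → Option (Fin n × (Fin B → Bool))} {N : Network n W}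
    {T : ℕ} {σ : ℕ → Fin n → Info n B} (h : IsRun γ send N T σ)
    (hs : ∀ i : Info n B, i.time < T → send i = send' i) : IsRun γ send' N T σ := by
  refine ⟨h.1, fun t ht u => ?_⟩
  obtain ⟨D, hD, hσ⟩ := h.2 t ht u
  have key : ∀ v, send (σ t v) = send' (σ t v) := fun v =>
    hs _ (by rw [(h.time_eq t ht.le v).1]; exact ht)
  refine ⟨D, ?_, ?_⟩
  · convert hD using 1
    ext q
    simp only [mem_addressedTo, key]
  · rw [hσ]
    simp only [HybridAlgorithm.contents, fullInfo, key]

theorem Learns.start :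
    Learns γ B 0 fun (N : Network n W) u => HybridAlgorithm.localView N.graph N.weight u := by
  refine ⟨fun _ => none, fun i => match i with | .start _ v => v | .step _ _ _ => fun _ => none, ?_⟩
  intro N σ h u
  rw [h.1 u]

theorem Learns.map {X Y : Type} {T : ℕ} {f : Network n W → Fin n → X} (hf : Learns γ B T f)
    (φ : Fin n → X → Y) : Learns γ B T fun N u => φ u (f N u) := by
  obtain ⟨send, read, h⟩ := hf
  refine ⟨send, fun i => φ i.ident (read i), fun N σ hσ u => ?_⟩
  simp only
  rw [h N σ hσ u, (hσ.time_eq T le_rfl u).2]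

theorem Learns.of_eq {X : Type} {T T' : ℕ} {f f' : Network n W → Fin n → X} (hf : Learns γ B T f)
    (hT : T = T') (h : ∀ N u, f N u = f' N u) : Learns γ B T' f' := by
  obtain rfl : f = f' := funext fun N => funext (h N)
  exact hT ▸ hf

-- Without collisions at most one message is addressed to `u`. Since `γ ≥ 1`, `Deliverable` then
-- forces `D` to be the full set, and the inbox does not depend on the adversary.
open Classical in
theorem contents_eq_received (hγ : 0 < γ) (send : Info n B → Option (Fin n × (Fin B → Bool)))
    (σ : Fin n → Info n B) (s : Fin n → Option (Fin n × ℕ)) (hs : CollisionFree s)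
    (hb : ∀ v u m, s v = some (u, m) → m < 2 ^ B)
    (hσ : ∀ v, send (σ v) = (s v).map fun q => (q.1, toBits B q.2))
    (u : Fin n) (D : Finset (Fin n × Fin γ))
    (hD : HybridAlgorithm.Deliverable ((fullInfo γ send fun _ _ => 0).addressedTo σ u) D) :
    (((fullInfo γ send fun _ _ => 0).contents σ D).map fun b => (bitsEquiv B b : ℕ)) =
      ((received s u).elim 0 fun m => {m}) := by
  obtain ⟨hsub, hcard, hfull⟩ := hD
  have hmem : ∀ q, q ∈ (fullInfo γ send fun _ _ => 0).addressedTo σ u ↔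
      q.2.val = 0 ∧ ∃ m, s q.1 = some (u, m) := by
    intro q
    rw [mem_addressedTo, hσ]
    refine and_congr_right fun _ => ?_
    simp only [Option.map_eq_some_iff]
    constructor
    · rintro ⟨m, ⟨u', m'⟩, h1, h2⟩
      simp only [Prod.mk.injEq] at h2
      exact ⟨m', by rw [h1, h2.1]⟩
    · rintro ⟨m, hm⟩
      exact ⟨toBits B m, (u, m), hm, rfl⟩
  cases hr : received s u with
  | none =>
    have hno : ¬ ∃ m v, s v = some (u, m) := by
      intro h
      unfold received at hr
      rw [dif_pos h] at hr
      cases hr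
    have : D = ∅ := by
      refine Finset.eq_empty_of_forall_notMem fun q hq => hno ?_
      obtain ⟨-, m, hm⟩ := (hmem q).1 (hsub hq)
      exact ⟨m, _, hm⟩
    subst this
    rfl
  | some m =>
    obtain ⟨v, hv⟩ := (received_eq_some hs).1 hr
    have hS : (fullInfo γ send fun _ _ => 0).addressedTo σ u = {(v, ⟨0, hγ⟩)} := by
      ext q
      rw [hmem, Finset.mem_singleton]
      constructor
      · rintro ⟨h0, m', hm'⟩
        exact Prod.ext (hs u _ _ _ _ hm' hv) (Fin.ext h0)
      · rintro rfl
        exact ⟨rfl, m, hv⟩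
    have hDS := hfull (by rw [hS, Finset.card_singleton]; exact hγ)
    rw [hDS, hS]
    have : (fullInfo γ send fun _ _ => 0).contents σ {(v, ⟨0, hγ⟩)} = {toBits B m} := by
      simp only [HybridAlgorithm.contents, fullInfo, Finset.singleton_val]
      rw [← Multiset.cons_zero, Multiset.filterMap_cons_some _ _ (b := toBits B m)]
      · rfl
      · simp [hσ, hv]
    rw [this]
    simp [bitsEquiv_toBits (hb v u m hv)]

open Classical in
/-- One more round: every node learns what its neighbours knew, and receives a global message. -/
theorem Learns.round {X : Type} {T : ℕ} {f : Network n W → Fin n → X} (hf : Learns γ B T f)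
    (hγ : 0 < γ) (s : Fin n → X → Option (Fin n × ℕ))
    (hb : ∀ N v u m, s v (f N v) = some (u, m) → m < 2 ^ B)
    (hs : ∀ N, CollisionFree fun v => s v (f N v)) :
    Learns γ B (T + 1) fun N u => (f N u,
      (fun v => if N.graph.Adj u v then some (f N v) else none),
      received (fun v => s v (f N v)) u) := by
  obtain ⟨send, read, h⟩ := hf
  refine ⟨fun i => if i.time < T then send i
      else (s i.ident (read i)).map fun q => (q.1, toBits B q.2),
    fun i => match i with
    | .start u v => (read (.start u v), fun _ => none, none)
    | .step i l c => (read i, fun v => (l v).map read,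
        (c.map fun b => (bitsEquiv B b : ℕ)).toList.head?), ?_⟩
  intro N σ hσ u
  have h0 : ∀ v, read (σ T v) = f N v :=
    h N σ ((hσ.mono (Nat.le_succ T)).congr fun i hi => if_pos hi)
  obtain ⟨D, hD, hσ'⟩ := hσ.2 T (Nat.lt_succ_self T) u
  rw [hσ']
  have := contents_eq_received hγ _ (σ T) (fun v => s v (f N v)) (hs N) (hb N) (by
    intro v
    have ht := hσ.time_eq T (Nat.le_succ T) v
    simp [ht.1, ht.2, h0]) u D hD
  simp only [this, h0]
  refine Prod.ext rfl (Prod.ext ?_ ?_)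
  · funext v
    by_cases hv : N.graph.Adj u v <;> simp [hv, h0]
  · cases received (fun v => s v (f N v)) u <;> simp

/-- In each round a node takes over whatever its neighbours knew; the first step of a shortest path
to `v` leads to a neighbour that is one hop closer to `v`. -/
theorem Learns.flood {X : Type} {T : ℕ} {f : Network n W → Fin n → X} (hf : Learns γ B T f)
    (hγ : 0 < γ) (R : ℕ) :
    Learns γ B (T + R) fun N u v => if N.graph.dist u v ≤ R then some (f N v) else none := by
  classical
  induction R with
  | zero =>
    refine (hf.map fun u x v => if u = v then some x else none).of_eq rfl fun N u => ?_
    funext v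
    by_cases h : u = v
    · simp [h]
    · simp [h, N.connected.dist_eq_zero_iff]
  | succ R ih =>
    have h1 := ih.round hγ (fun _ _ => none) (by simp) (fun N u v v' m m' h => by simp at h)
    refine (h1.map fun u x v => if ∃ z y, x.2.1 z = some y ∧ (y v).isSome then
      (if h : ∃ a, ∃ z y, x.2.1 z = some y ∧ y v = some a then some h.choose else none)
      else x.1 v).of_eq rfl fun N u => ?_
    funext v
    simp only
    split_ifs with h2 h3 h4 h5 h6 h7 h8
    · have h5 := h3.choose_spec
      obtain ⟨z, y, hz, hy⟩ := h5
      split_ifs at hz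
      simp only [Option.some.injEq] at hz
      subst hz
      simp only at hy
      split_ifs at hy
      exact hy.symm
    · exfalso
      apply h4
      obtain ⟨z, y, hz, hy⟩ := h2
      split_ifs at hz with hz'
      simp only [Option.some.injEq] at hz
      subst hz
      simp only at hy
      split_ifs at hy with hy'
      · have := N.connected.dist_triangle (u := u) (v := z) (w := v)
        rw [SimpleGraph.dist_eq_one_iff_adj.2 hz'] at this
        omega
      · simp at hy
    · exfalso
      obtain ⟨z, y, hz, hy⟩ := h2
      obtain ⟨a, ha⟩ := Option.isSome_iff_exists.1 hy
      exact h3 ⟨a, z, y, hz, ha⟩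
    · exfalso
      obtain ⟨z, y, hz, hy⟩ := h2
      obtain ⟨a, ha⟩ := Option.isSome_iff_exists.1 hy
      exact h3 ⟨a, z, y, hz, ha⟩
    · rfl
    · omega
    · exfalso
      apply h2
      have hne : u ≠ v := by
        rintro rfl
        simp at h6
      obtain ⟨P, hP⟩ := N.connected.exists_walk_length_eq_dist u v
      cases P with
      | nil => exact absurd rfl hne
      | @cons _ z _ hz P =>
        refine ⟨z, _, if_pos hz, ?_⟩
        have := SimpleGraph.dist_le P
        rw [SimpleGraph.Walk.length_cons] at hP
        rw [if_pos (by omega)]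
        rfl
    · rfl

/-- A sequence of global messages that depend on present knowledge only. -/
theorem Learns.schedule {X : Type} {T : ℕ} {f : Network n W → Fin n → X} (hf : Learns γ B T f)
    (hγ : 0 < γ) (L : ℕ) (s : ℕ → Fin n → X → Option (Fin n × ℕ))
    (hb : ∀ t N v u m, s t v (f N v) = some (u, m) → m < 2 ^ B)
    (hs : ∀ t N, CollisionFree fun v => s t v (f N v)) :
    Learns γ B (T + L) fun N u => (f N u,
      fun t => if t < L then received (fun v => s t v (f N v)) u else none) := by
  induction L with
  | zero => exact (hf.map fun _ x => (x, fun _ => none)).of_eq rfl fun N u => by simp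
  | succ L ih =>
    refine ((ih.round hγ (fun v x => s L v x.1) (fun N => hb L N) (hs L)).map fun _ x =>
      (x.1.1, fun t => if t = L then x.2.2 else x.1.2 t)).of_eq rfl fun N u => ?_
    refine Prod.ext rfl (funext fun t => ?_)
    simp only
    split_ifs with h1 h2 h3 h4 h5
    · rw [h1]
    · omega
    · rfl
    · omega
    · omega
    · rfl

open Fin.CommRing in
/-- The maximum over all nodes becomes known to all nodes: in its `i`-th round, node `u` sends the
maximum that it knows to node `u + 2 ^ i`. -/
theorem Learns.sup {X : Type} {T : ℕ} {f : Network n W → Fin n → X} (hf : Learns γ B T f)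
    (hγ : 0 < γ) (val : Fin n → X → ℕ) (hb : ∀ N v, val v (f N v) < 2 ^ B) :
    Learns γ B (T + Nat.clog 2 n) fun N u =>
      (f N u, Finset.univ.sup fun v => val v (f N v)) := by
  obtain rfl | hn := n.eq_zero_or_pos
  · obtain ⟨send, read, h⟩ := hf.map fun u x => (x, 0)
    exact ⟨send, read, fun N σ hσ u => u.elim0⟩
  have : NeZero n := ⟨hn.ne'⟩
  -- After `i` rounds `u` knows the maximum over the cyclic window of `2 ^ i` nodes that ends at
  -- `u`. The shift by `2 ^ i` is injective, which excludes collisions, and doubles the window;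
  -- wrapping around does not affect a maximum.
  have key : ∀ i, Learns γ B (T + i) fun N u =>
      (f N u, (Finset.range (2 ^ i)).sup fun k => val (u - (k : Fin n)) (f N (u - (k : Fin n)))) := by
    intro i
    induction i with
    | zero => exact (hf.map fun u x => (x, val u x)).of_eq rfl fun N u => by simp
    | succ i ih =>
      have hcf : ∀ N : Network n W, CollisionFree fun v => some (v + ((2 ^ i : ℕ) : Fin n),
          (Finset.range (2 ^ i)).sup
            fun k => val (v - (k : Fin n)) (f N (v - (k : Fin n)))) := by
        intro N u v v' m m' h h'
        simp only [Option.some.injEq, Prod.mk.injEq] at h h'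
        exact add_right_cancel (h.1.trans h'.1.symm)
      refine ((ih.round hγ (fun v x => some (v + ((2 ^ i : ℕ) : Fin n), x.2)) ?_ hcf).map
        fun u x => (x.1.1, max x.1.2 (x.2.2.getD 0))).of_eq rfl fun N u => ?_
      · intro N v u m h
        simp only [Option.some.injEq, Prod.mk.injEq] at h
        rw [← h.2]
        exact (Finset.sup_lt_iff (by positivity)).2 fun k _ => hb N _
      · refine Prod.ext rfl ?_
        have hr := (received_eq_some (hcf N) (u := u)).2
          ⟨u - ((2 ^ i : ℕ) : Fin n), by rw [sub_add_cancel]⟩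
        simp only at hr ⊢
        rw [hr, Option.getD_some]
        apply le_antisymm
        · refine max_le (Finset.sup_mono ?_) (Finset.sup_le fun k hk => ?_)
          · exact Finset.range_mono (Nat.pow_le_pow_right two_pos i.le_succ)
          · rw [Finset.mem_range] at hk
            have : u - ((2 ^ i : ℕ) : Fin n) - (k : Fin n) = u - ((2 ^ i + k : ℕ) : Fin n) := by
              rw [sub_sub, Nat.cast_add]
            rw [this]
            exact Finset.le_sup
              (f := fun k : ℕ => val (u - (k : Fin n)) (f N (u - (k : Fin n))))
              (Finset.mem_range.2 (by rw [pow_succ]; omega))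
        · refine Finset.sup_le fun k hk => ?_
          rw [Finset.mem_range, pow_succ] at hk
          by_cases hki : k < 2 ^ i
          · exact le_max_of_le_left (Finset.le_sup
              (f := fun k : ℕ => val (u - (k : Fin n)) (f N (u - (k : Fin n))))
              (Finset.mem_range.2 hki))
          · obtain ⟨k, rfl⟩ := Nat.exists_eq_add_of_le (not_lt.1 hki)
            have : u - ((2 ^ i + k : ℕ) : Fin n) = u - ((2 ^ i : ℕ) : Fin n) - (k : Fin n) := by
              rw [sub_sub, Nat.cast_add]
            rw [this]
            exact le_max_of_le_right (Finset.le_sup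
              (f := fun k : ℕ => val (u - ((2 ^ i : ℕ) : Fin n) - (k : Fin n))
                (f N (u - ((2 ^ i : ℕ) : Fin n) - (k : Fin n))))
              (Finset.mem_range.2 (by omega)))
  refine (key (Nat.clog 2 n)).of_eq rfl fun N u => congrArg (Prod.mk (f N u)) (le_antisymm ?_ ?_)
  · exact Finset.sup_le fun k _ =>
      Finset.le_sup (f := fun v => val v (f N v)) (Finset.mem_univ _)
  · refine Finset.sup_le fun v _ => ?_
    have h1 : (u - v).val < 2 ^ Nat.clog 2 n :=
      (u - v).isLt.trans_le (Nat.le_pow_clog one_lt_two n)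
    have h2 : u - (((u - v).val : ℕ) : Fin n) = v := by
      rw [Fin.cast_val_eq_self, sub_sub_cancel]
    have := Finset.le_sup (f := fun k : ℕ => val (u - (k : Fin n)) (f N (u - (k : Fin n))))
      (Finset.mem_range.2 h1)
    simp only [h2] at this
    exact this

/-- The results of a sequence of maximizations, each of which may depend on the earlier ones. -/
def supHistory (val : Fin n → List ℕ → ℕ) : ℕ → List ℕ
  | 0 => []
  | k + 1 => supHistory val k ++ [Finset.univ.sup fun v => val v (supHistory val k)]

theorem Learns.supHistory {X : Type} {T : ℕ} {f : Network n W → Fin n → X} (hf : Learns γ B T f)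
    (hγ : 0 < γ) (val : Fin n → X → List ℕ → ℕ) (hb : ∀ N v l, val v (f N v) l < 2 ^ B) (K : ℕ) :
    Learns γ B (T + K * Nat.clog 2 n) fun N u =>
      (f N u, _root_.supHistory (fun v => val v (f N v)) K) := by
  induction K with
  | zero =>
    exact (hf.map fun _ x => (x, ([] : List ℕ))).of_eq (by simp) fun N u => rfl
  | succ K ih =>
    refine ((ih.sup hγ (fun v x => val v x.1 x.2) fun N v => hb N v _).map fun _ x =>
      (x.1.1, x.1.2 ++ [x.2])).of_eq (by ring) fun N u => rfl

end Learns

/-! ### Hop-limited distances -/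

/-- The smallest weight of a walk with at most `k` edges in the graph in which `view x` lists the
edges at `x` with their weights. -/
noncomputable def hopDist {n : ℕ} (view : Fin n → Fin n → Option ℕ) : ℕ → Fin n → Fin n → ℕ∞
  | 0, x, y => if x = y then 0 else ⊤
  | k + 1, x, y =>
    min (hopDist view k x y) (⨅ z, (view x z).elim ⊤ fun c => (c : ℕ∞) + hopDist view k z y)

section Walks

variable {V : Type} {G : SimpleGraph V} (w : Sym2 V → ℕ)

theorem walkWeight_nil (u : V) : walkWeight w (SimpleGraph.Walk.nil : G.Walk u u) = 0 := rfl

theorem walkWeight_cons {u v x : V} (h : G.Adj u v) (P : G.Walk v x) :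
    walkWeight w (P.cons h) = w s(u, v) + walkWeight w P := by
  simp [walkWeight]

theorem walkWeight_append {u v x : V} (P : G.Walk u v) (Q : G.Walk v x) :
    walkWeight w (P.append Q) = walkWeight w P + walkWeight w Q := by
  simp [walkWeight]

theorem walkWeight_reverse {u v : V} (P : G.Walk u v) :
    walkWeight w P.reverse = walkWeight w P := by
  simp [walkWeight, List.sum_reverse]

theorem walkWeight_bypass_le [DecidableEq V] {u v : V} (P : G.Walk u v) :
    walkWeight w P.bypass ≤ walkWeight w P :=
  (P.edges_bypass_sublist_edges.map w).sum_le_sum fun _ _ => Nat.zero_le _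

theorem weightedDist_le_walkWeight {u v : V} (P : G.Walk u v) :
    weightedDist G w u v ≤ walkWeight w P := by
  classical
  exact (iInf_le _ P.toPath).trans (by exact_mod_cast walkWeight_bypass_le w P)

theorem exists_walkWeight_eq_weightedDist {u v : V} (h : G.Reachable u v) :
    ∃ P : G.Walk u v, (walkWeight w P : ℕ∞) = weightedDist G w u v := by
  classical
  obtain ⟨P⟩ := h
  have : Nonempty (G.Path u v) := ⟨P.toPath⟩
  obtain ⟨Q, hQ⟩ := ENat.exists_eq_iInf fun P : G.Path u v => (walkWeight w P.1 : ℕ∞)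
  exact ⟨Q.1, hQ⟩

end Walks

namespace Network

variable {n W : ℕ} (N : Network n W)

/-- The initial knowledge of all nodes. -/
noncomputable def view : Fin n → Fin n → Option ℕ :=
  HybridAlgorithm.localView N.graph N.weight

theorem view_of_adj {x z : Fin n} (h : N.graph.Adj x z) :
    N.view x z = some (N.weight s(x, z)) := if_pos h

theorem view_of_not_adj {x z : Fin n} (h : ¬ N.graph.Adj x z) : N.view x z = none := if_neg h

theorem hopDist_le_walkWeight {x y : Fin n} (P : N.graph.Walk x y) :
    ∀ {k : ℕ}, P.length ≤ k → hopDist N.view k x y ≤ walkWeight N.weight P := by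
  induction P with
  | nil =>
    intro k _
    induction k with
    | zero => simp [hopDist]
    | succ k ih => exact (min_le_left _ _).trans (ih (by simp))
  | @cons x z y h P ih =>
    intro k hk
    rw [SimpleGraph.Walk.length_cons] at hk
    obtain ⟨k, rfl⟩ : ∃ j, k = j + 1 := ⟨k - 1, by omega⟩
    refine (min_le_right _ _).trans ((iInf_le _ z).trans ?_)
    rw [N.view_of_adj h, Option.elim_some, walkWeight_cons, Nat.cast_add]
    exact add_le_add le_rfl (ih (by omega))

theorem exists_walkWeight_eq_hopDist {k : ℕ} : ∀ {x y : Fin n}, hopDist N.view k x y ≠ ⊤ →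
    ∃ P : N.graph.Walk x y, P.length ≤ k ∧ (walkWeight N.weight P : ℕ∞) = hopDist N.view k x y := by
  induction k with
  | zero =>
    intro x y h
    by_cases hxy : x = y
    · subst hxy
      exact ⟨.nil, le_rfl, by simp [hopDist, walkWeight_nil]⟩
    · exact absurd (if_neg hxy) h
  | succ k ih =>
    intro x y h
    obtain h1 | h1 := min_choice (hopDist N.view k x y)
      (⨅ z, (N.view x z).elim ⊤ fun c => (c : ℕ∞) + hopDist N.view k z y)
    · have h2 : hopDist N.view (k + 1) x y = hopDist N.view k x y := h1
      rw [h2] at h ⊢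
      obtain ⟨P, hP, hw⟩ := ih h
      exact ⟨P, by omega, hw⟩
    · have h2 : hopDist N.view (k + 1) x y =
        ⨅ z, (N.view x z).elim ⊤ fun c => (c : ℕ∞) + hopDist N.view k z y := h1
      have : Nonempty (Fin n) := ⟨x⟩
      obtain ⟨z, hz⟩ := ENat.exists_eq_iInf
        fun z => (N.view x z).elim ⊤ fun c => (c : ℕ∞) + hopDist N.view k z y
      rw [h2, ← hz] at h ⊢
      by_cases hadj : N.graph.Adj x z
      · rw [N.view_of_adj hadj, Option.elim_some] at h ⊢
        obtain ⟨P, hP, hw⟩ := ih (x := z) (y := y) fun h' => h (by simp [h'])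
        refine ⟨P.cons hadj, by simpa using hP, ?_⟩
        rw [walkWeight_cons, Nat.cast_add, hw]
      · rw [N.view_of_not_adj hadj] at h
        exact absurd rfl h

theorem hopDist_anti {x y : Fin n} {i j : ℕ} (h : i ≤ j) :
    hopDist N.view j x y ≤ hopDist N.view i x y := by
  by_cases h' : hopDist N.view i x y = ⊤
  · rw [h']; exact le_top
  · obtain ⟨P, hP, hw⟩ := N.exists_walkWeight_eq_hopDist h'
    exact hw ▸ N.hopDist_le_walkWeight P (hP.trans h)

theorem hopDist_triangle (i j : ℕ) (x s y : Fin n) :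
    hopDist N.view (i + j) x y ≤ hopDist N.view i x s + hopDist N.view j s y := by
  by_cases h1 : hopDist N.view i x s = ⊤
  · simp [h1]
  by_cases h2 : hopDist N.view j s y = ⊤
  · simp [h2]
  obtain ⟨P, hP, hPw⟩ := N.exists_walkWeight_eq_hopDist h1
  obtain ⟨Q, hQ, hQw⟩ := N.exists_walkWeight_eq_hopDist h2
  rw [← hPw, ← hQw, ← Nat.cast_add, ← walkWeight_append]
  exact N.hopDist_le_walkWeight _ (by rw [SimpleGraph.Walk.length_append]; omega)

theorem hopDist_symm_le (k : ℕ) (x y : Fin n) : hopDist N.view k x y ≤ hopDist N.view k y x := by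
  by_cases h : hopDist N.view k y x = ⊤
  · rw [h]; exact le_top
  · obtain ⟨P, hP, hw⟩ := N.exists_walkWeight_eq_hopDist h
    rw [← hw, ← walkWeight_reverse]
    exact N.hopDist_le_walkWeight _ (by simpa using hP)

theorem hopDist_symm (k : ℕ) (x y : Fin n) : hopDist N.view k x y = hopDist N.view k y x :=
  le_antisymm (N.hopDist_symm_le k x y) (N.hopDist_symm_le k y x)

theorem dist_le_of_hopDist_ne_top {k : ℕ} {x y : Fin n} (h : hopDist N.view k x y ≠ ⊤) :
    N.graph.dist x y ≤ k := by
  obtain ⟨P, hP, -⟩ := N.exists_walkWeight_eq_hopDist h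
  exact (SimpleGraph.dist_le P).trans hP

theorem hopDist_le_mul {k : ℕ} {x y : Fin n} (h : hopDist N.view k x y ≠ ⊤) :
    hopDist N.view k x y ≤ (k * W : ℕ) := by
  obtain ⟨P, hP, hw⟩ := N.exists_walkWeight_eq_hopDist h
  rw [← hw, Nat.cast_le]
  calc walkWeight N.weight P ≤ (P.edges.map N.weight).length * W := by
        refine List.sum_le_card_nsmul _ _ fun m hm => ?_
        obtain ⟨e, he, rfl⟩ := List.mem_map.1 hm
        exact N.weight_le e (P.edges_subset_edgeSet he)
    _ ≤ k * W := by
        rw [List.length_map, SimpleGraph.Walk.length_edges]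
        exact Nat.mul_le_mul_right _ hP

theorem weightedDist_le_hopDist (k : ℕ) (x y : Fin n) :
    weightedDist N.graph N.weight x y ≤ hopDist N.view k x y := by
  by_cases h : hopDist N.view k x y = ⊤
  · rw [h]; exact le_top
  · obtain ⟨P, -, hw⟩ := N.exists_walkWeight_eq_hopDist h
    exact hw ▸ weightedDist_le_walkWeight _ P

theorem exists_hopDist_eq_weightedDist (x y : Fin n) :
    ∃ k, hopDist N.view k x y = weightedDist N.graph N.weight x y := by
  obtain ⟨P, hP⟩ := exists_walkWeight_eq_weightedDist N.weight (N.connected x y)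
  exact ⟨P.length, le_antisymm (hP ▸ N.hopDist_le_walkWeight P le_rfl)
    (N.weightedDist_le_hopDist _ _ _)⟩

theorem weightedDist_ne_top (x y : Fin n) : weightedDist N.graph N.weight x y ≠ ⊤ := by
  obtain ⟨P, hP⟩ := exists_walkWeight_eq_weightedDist N.weight (N.connected x y)
  rw [← hP]
  exact ENat.natCast_ne_top _

theorem weightedDist_triangle (x s y : Fin n) : weightedDist N.graph N.weight x y ≤
    weightedDist N.graph N.weight x s + weightedDist N.graph N.weight s y := by
  obtain ⟨P, hP⟩ := exists_walkWeight_eq_weightedDist N.weight (N.connected x s)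
  obtain ⟨Q, hQ⟩ := exists_walkWeight_eq_weightedDist N.weight (N.connected s y)
  rw [← hP, ← hQ, ← Nat.cast_add, ← walkWeight_append]
  exact weightedDist_le_walkWeight _ _

/-- A walk with at most `k` edges from `x` stays within `k` hops of `x`, so only the views of those
nodes matter. -/
theorem hopDist_congr {view : Fin n → Fin n → Option ℕ} :
    ∀ {k : ℕ} {x : Fin n}, (∀ z, N.graph.dist x z ≤ k → view z = N.view z) → ∀ y,
      hopDist view k x y = hopDist N.view k x y := by
  intro k
  induction k with
  | zero => intro x _ y; rfl
  | succ k ih =>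
    intro x h y
    rw [hopDist, hopDist, ih (fun z hz => h z (by omega)), h x (by simp)]
    congr 2
    funext z
    by_cases hadj : N.graph.Adj x z
    · rw [ih (x := z) fun z' hz' => h z' ?_]
      have := N.connected.dist_triangle (u := x) (v := z) (w := z')
      rw [SimpleGraph.dist_eq_one_iff_adj.2 hadj] at this
      omega
    · simp [N.view_of_not_adj hadj]

end Network

/-! ### Critical sets -/

open Classical in
/-- The nodes other than `x` on lightest walks with at most `h` edges from `x` to `y`, if such a
walk needs `h` edges. -/
noncomputable def critical {n : ℕ} (view : Fin n → Fin n → Option ℕ) (h : ℕ) (x y : Fin n) :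
    Finset (Fin n) :=
  Finset.univ.filter fun s => hopDist view h x y < hopDist view (h - 1) x y ∧
    ∃ i, 1 ≤ i ∧ i ≤ h ∧ hopDist view i x s + hopDist view (h - i) s y ≤ hopDist view h x y

namespace Network

variable {n W : ℕ} (N : Network n W)

theorem mem_critical {view : Fin n → Fin n → Option ℕ} {h : ℕ} {x y s : Fin n} :
    s ∈ critical view h x y ↔ hopDist view h x y < hopDist view (h - 1) x y ∧
    ∃ i, 1 ≤ i ∧ i ≤ h ∧ hopDist view i x s + hopDist view (h - i) s y ≤ hopDist view h x y := by
  simp [critical]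

theorem dist_le_of_mem_critical {h : ℕ} {x y s : Fin n} (hs : s ∈ critical N.view h x y) :
    N.graph.dist x s ≤ h := by
  obtain ⟨hlt, i, -, hi, hle⟩ := mem_critical.1 hs
  refine (N.dist_le_of_hopDist_ne_top (k := i) fun htop => ?_).trans hi
  rw [htop, top_add, top_le_iff] at hle
  rw [hle] at hlt
  exact not_top_lt hlt

/-- The radius is `2 * h` because the second summand starts at a node `s` up to `i` hops from `x`
and explores `h - i` hops further; if `s` is not reachable within `i` edges, both sums are infinite.
-/
theorem critical_congr {view : Fin n → Fin n → Option ℕ} {h : ℕ} {x : Fin n}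
    (hv : ∀ z, N.graph.dist x z ≤ 2 * h → view z = N.view z) (y : Fin n) :
    critical view h x y = critical N.view h x y := by
  have key : ∀ i ≤ h, ∀ s, hopDist view i x s = hopDist N.view i x s := fun i hi s =>
    N.hopDist_congr (fun z hz => hv z (by omega)) s
  ext s
  rw [mem_critical, mem_critical, key h le_rfl, key (h - 1) (by omega)]
  refine and_congr_right fun hlt => exists_congr fun i => and_congr_right fun _ =>
    and_congr_right fun hi => ?_
  rw [key i hi]
  by_cases htop : hopDist N.view i x s = ⊤
  · simp [htop]
  · rw [N.hopDist_congr (x := s) (k := h - i) fun z hz => hv z ?_]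
    have h1 := N.connected.dist_triangle (u := x) (v := s) (w := z)
    have h2 := N.dist_le_of_hopDist_ne_top htop
    omega

/-- A lightest walk with its cycles removed is still lightest, hence cannot have fewer than `h`
edges. It is a path with exactly `h` edges, and its `h` nodes after `x` are distinct and critical.
-/
theorem le_card_critical {h : ℕ} {x y : Fin n}
    (hlt : hopDist N.view h x y < hopDist N.view (h - 1) x y) :
    h ≤ (critical N.view h x y).card := by
  obtain ⟨P, hP, hw⟩ := N.exists_walkWeight_eq_hopDist hlt.ne_top
  set R := P.bypass with hR
  have hRw : (walkWeight N.weight R : ℕ∞) ≤ hopDist N.view h x y := by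
    rw [← hw]; exact_mod_cast walkWeight_bypass_le _ P
  have hRl : R.length = h := by
    refine le_antisymm (P.length_bypass_le_length.trans hP) (not_lt.1 fun hl => ?_)
    exact hlt.not_ge ((N.hopDist_le_walkWeight R (by omega)).trans hRw)
  have hRp : R.IsPath := P.bypass_isPath
  have hsub : R.support.tail.toFinset ⊆ critical N.view h x y := by
    intro s hs
    rw [List.mem_toFinset] at hs
    have hs' : s ∈ R.support := List.mem_of_mem_tail hs
    refine mem_critical.2 ⟨hlt, (R.takeUntil s hs').length, ?_, ?_, ?_⟩
    · refine Nat.one_le_iff_ne_zero.2 fun h0 => ?_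
      obtain rfl := SimpleGraph.Walk.eq_of_length_eq_zero h0
      have hnd := hRp.support_nodup
      rw [← SimpleGraph.Walk.cons_tail_support] at hnd
      exact (List.nodup_cons.1 hnd).1 hs
    · rw [← hRl]; exact R.length_takeUntil_le_length hs'
    · have hsum : (R.takeUntil s hs').length + (R.dropUntil s hs').length = h := by
        rw [← SimpleGraph.Walk.length_append, R.take_spec, hRl]
      refine le_trans (add_le_add (N.hopDist_le_walkWeight _ le_rfl)
        (N.hopDist_le_walkWeight (R.dropUntil s hs') (by omega))) ?_
      rw [← Nat.cast_add, ← walkWeight_append, R.take_spec]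
      exact hRw
  calc h = R.support.tail.toFinset.card := by
        rw [List.toFinset_card_of_nodup (hRp.support_nodup.sublist (List.tail_sublist _)),
          List.length_tail, SimpleGraph.Walk.length_support, hRl, Nat.add_sub_cancel]
    _ ≤ _ := Finset.card_le_card hsub

end Network

/-! ### Decomposing distances into routes -/

/-- `c` is a sum of values of `E` along a sequence of nodes from `x` to `y`. -/
inductive Route {V : Type} (E : V → V → ℕ → Prop) : V → V → ℕ → Prop
  | single {x y c} : E x y c → Route E x y c
  | cons {x s y a b} : E x s a → Route E s y b → Route E x y (a + b)

namespace Network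

variable {n W : ℕ} (N : Network n W)

theorem weightedDist_le_of_route {E : Fin n → Fin n → ℕ → Prop} {h : ℕ}
    (hE : ∀ x y c, E x y c → hopDist N.view h x y = c) {x y : Fin n} {c : ℕ}
    (hr : Route E x y c) : weightedDist N.graph N.weight x y ≤ c := by
  induction hr with
  | single hxy => exact hE _ _ _ hxy ▸ N.weightedDist_le_hopDist _ _ _
  | @cons x s y _ _ hxs _ ih =>
    refine (N.weightedDist_triangle x s y).trans ?_
    rw [Nat.cast_add]
    exact add_le_add (hE _ _ _ hxs ▸ N.weightedDist_le_hopDist _ _ _) ih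

/-- If `S` meets all critical sets, then distances from nodes in `A ⊇ S` are attained by routes
through `S`. -/
theorem exists_route {E : Fin n → Fin n → ℕ → Prop} {h : ℕ} (hh : 0 < h) {A S : Set (Fin n)}
    (hSA : S ⊆ A) (hdirect : ∀ x ∈ A, ∀ y c, hopDist N.view h x y = (c : ℕ) → E x y c)
    (hS : ∀ x y, (critical N.view h x y).Nonempty → ∃ s ∈ S, s ∈ critical N.view h x y)
    {x y : Fin n} (hx : x ∈ A) :
    ∃ c : ℕ, (c : ℕ∞) = weightedDist N.graph N.weight x y ∧ Route E x y c := by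
  obtain ⟨L, hL⟩ := N.exists_hopDist_eq_weightedDist x y
  induction L using Nat.strong_induction_on generalizing x with
  | _ L ih =>
  -- Induction on the number `L` of edges that suffice for the distance; `L` may be taken minimal.
  by_cases hmin : ∃ L' < L, hopDist N.view L' x y = weightedDist N.graph N.weight x y
  · obtain ⟨L', hL', h'⟩ := hmin
    exact ih L' hL' hx h'
  push Not at hmin
  obtain ⟨D, hD⟩ := ENat.ne_top_iff_exists.1 (N.weightedDist_ne_top x y)
  by_cases hLh : L ≤ h
  · refine ⟨D, hD, .single (hdirect x hx y D ?_)⟩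
    rw [hD]
    exact le_antisymm ((N.hopDist_anti hLh).trans hL.le) (N.weightedDist_le_hopDist _ _ _)
  push Not at hLh
  obtain ⟨P, hP, hw⟩ := N.exists_walkWeight_eq_hopDist (hL ▸ N.weightedDist_ne_top x y)
  set z := P.getVert h with hz
  have hsplit : walkWeight N.weight (P.take h) + walkWeight N.weight (P.drop h) =
      walkWeight N.weight P := by
    rw [← walkWeight_append, SimpleGraph.Walk.append_take_drop_eq]
  have h1 : hopDist N.view h x z ≤ walkWeight N.weight (P.take h) :=
    N.hopDist_le_walkWeight _ (by simp)
  have h2 : hopDist N.view (L - h) z y ≤ walkWeight N.weight (P.drop h) :=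
    N.hopDist_le_walkWeight _ (by simp; omega)
  have h12 : hopDist N.view h x z + hopDist N.view (L - h) z y ≤
      weightedDist N.graph N.weight x y := by
    rw [← hL, ← hw, ← hsplit, Nat.cast_add]
    exact add_le_add h1 h2
  -- Reaching `z` equally cheaply with `h - 1` edges would contradict the minimality of `L`, so the
  -- critical set of `x` and `z` is nonempty.
  have hlt : hopDist N.view h x z < hopDist N.view (h - 1) x z := by
    refine lt_of_not_ge fun hge => hmin ((h - 1) + (L - h)) (by omega) ?_
    exact le_antisymm ((N.hopDist_triangle _ _ x z y).trans ((add_le_add hge le_rfl).trans h12))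
      (N.weightedDist_le_hopDist _ _ _)
  -- The hitter `s` need not lie on `P`, but rerouting through it costs nothing, and `L - i` edges
  -- with `i ≥ 1` suffice from `s` to `y`.
  obtain ⟨s, hsS, hs⟩ := hS x z (Finset.card_pos.1 (hh.trans_le (N.le_card_critical hlt)))
  obtain ⟨-, i, hi1, hih, hi⟩ := mem_critical.1 hs
  have hsy : hopDist N.view (h - i + (L - h)) s y ≤
      hopDist N.view (h - i) s z + hopDist N.view (L - h) z y := N.hopDist_triangle _ _ _ _ _
  have htot : hopDist N.view i x s + hopDist N.view (h - i + (L - h)) s y ≤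
      weightedDist N.graph N.weight x y := by
    refine (add_le_add le_rfl hsy).trans ?_
    rw [← add_assoc]
    exact (add_le_add hi le_rfl).trans h12
  have htot' : hopDist N.view h x s + hopDist N.view (h - i + (L - h)) s y ≤
      weightedDist N.graph N.weight x y :=
    (add_le_add (N.hopDist_anti hih) le_rfl).trans htot
  have hxs := N.weightedDist_le_hopDist h x s
  have hsy' := N.weightedDist_le_hopDist (h - i + (L - h)) s y
  have htri := N.weightedDist_triangle x s y
  obtain ⟨a, ha⟩ := ENat.ne_top_iff_exists.1
    (show hopDist N.view h x s ≠ ⊤ from fun h' => by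
      rw [h', top_add, top_le_iff] at htot'; exact N.weightedDist_ne_top _ _ htot')
  obtain ⟨b, hb⟩ := ENat.ne_top_iff_exists.1
    (show hopDist N.view (h - i + (L - h)) s y ≠ ⊤ from fun h' => by
      rw [h', add_top, top_le_iff] at htot'; exact N.weightedDist_ne_top _ _ htot')
  obtain ⟨a', ha'⟩ := ENat.ne_top_iff_exists.1 (N.weightedDist_ne_top x s)
  obtain ⟨b', hb'⟩ := ENat.ne_top_iff_exists.1 (N.weightedDist_ne_top s y)
  rw [← ha, ← ha', Nat.cast_le] at hxs
  rw [← hb, ← hb', Nat.cast_le] at hsy'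
  rw [← hD, ← ha', ← hb', ← Nat.cast_add, Nat.cast_le] at htri
  rw [← hD, ← ha, ← hb, ← Nat.cast_add, Nat.cast_le] at htot'
  obtain ⟨c, hc, hr⟩ := ih (h - i + (L - h)) (by omega) (hSA hsS)
    (by rw [← hb, ← hb', show b = b' by omega])
  refine ⟨a + c, ?_, .cons (hdirect x hx s a ha.symm) hr⟩
  rw [← hb', Nat.cast_inj] at hc
  rw [← hD, Nat.cast_inj]
  omega

end Network

/-! ### Greedy hitting sets -/

theorem supHistory_eq_map {n : ℕ} (val : Fin n → List ℕ → ℕ) (K : ℕ) :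
    supHistory val K =
      (List.range K).map fun k => Finset.univ.sup fun v => val v (supHistory val k) := by
  induction K with
  | zero => rfl
  | succ K ih => rw [List.range_succ, List.map_append, ← ih]; rfl

theorem supHistory_getD {n : ℕ} (val : Fin n → List ℕ → ℕ) {k K : ℕ} (h : k < K) :
    (supHistory val K).getD k 0 = Finset.univ.sup fun v => val v (supHistory val k) := by
  rw [supHistory_eq_map val K]
  simp [List.getD, h]

section HittingSet

variable {n : ℕ}

/-- The nodes that are named by numbers in `l`, modulo `n`. -/
def picked (n : ℕ) (l : List ℕ) : Set (Fin n) := {s | ∃ a ∈ l, a % n = s.val}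

open Classical in
/-- The indices of those nonempty members of the family `F` that `l` does not hit. -/
noncomputable def unhit (F : Fin n → Fin n → Finset (Fin n)) (l : List ℕ) :
    Finset (Fin n × Fin n) :=
  Finset.univ.filter fun p => (F p.1 p.2).Nonempty ∧ ∀ s ∈ F p.1 p.2, s ∉ picked n l

/-- The number of sets that `u` would hit in addition, together with `u`. -/
noncomputable def hitVal (F : Fin n → Fin n → Finset (Fin n)) (u : Fin n) (l : List ℕ) : ℕ :=
  ((unhit F l).filter fun p => u ∈ F p.1 p.2).card * n + u

theorem mem_unhit {F : Fin n → Fin n → Finset (Fin n)} {l : List ℕ} {p : Fin n × Fin n} :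
    p ∈ unhit F l ↔ (F p.1 p.2).Nonempty ∧ ∀ s ∈ F p.1 p.2, s ∉ picked n l := by
  simp [unhit]

/-- The value counts only sets that contain `u`. So `u` can compute it without knowing the other
sets, provided that its substitutes for them do not contain `u`. -/
theorem hitVal_congr {F F' : Fin n → Fin n → Finset (Fin n)} {u : Fin n}
    (h : ∀ x y, u ∈ F x y → F' x y = F x y) (h' : ∀ x y, u ∈ F' x y → F' x y = F x y)
    (l : List ℕ) : hitVal F' u l = hitVal F u l := by
  unfold hitVal
  congr 3
  ext p
  simp only [Finset.mem_filter, mem_unhit]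
  constructor
  · rintro ⟨h1, h2⟩
    rw [h' _ _ h2] at h1 h2
    exact ⟨h1, h2⟩
  · rintro ⟨h1, h2⟩
    rw [h _ _ h2]
    exact ⟨h1, h2⟩

theorem hitVal_lt (F : Fin n → Fin n → Finset (Fin n)) (u : Fin n) (l : List ℕ) :
    hitVal F u l < n ^ 3 + n := by
  have h1 : ((unhit F l).filter fun p => u ∈ F p.1 p.2).card ≤ n * n :=
    (Finset.card_le_univ _).trans (by simp)
  have h2 := Nat.mul_le_mul_right n h1
  have h3 := u.isLt
  unfold hitVal
  rw [show n ^ 3 = n * n * n by ring]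
  omega

/-- By double counting, sets with at least `h` members put an average load of at least an `h / n`
fraction of the unhit sets on the nodes; the node of maximal load hits at least that fraction. -/
theorem unhit_card_le {F : Fin n → Fin n → Finset (Fin n)} {h : ℕ}
    (hF : ∀ x y, (F x y).Nonempty → h ≤ (F x y).card) (l : List ℕ) :
    n * (unhit F (l ++ [Finset.univ.sup fun u => hitVal F u l])).card ≤
      (n - h) * (unhit F l).card := by
  obtain rfl | hn := n.eq_zero_or_pos
  · simp
  set U := unhit F l with hU
  let load : Fin n → ℕ := fun u => (U.filter fun p => u ∈ F p.1 p.2).card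
  have hval : ∀ u, hitVal F u l = load u * n + u := fun u => rfl
  have hne : (Finset.univ : Finset (Fin n)).Nonempty := ⟨⟨0, hn⟩, Finset.mem_univ _⟩
  obtain ⟨m, -, hm⟩ := Finset.exists_mem_eq_sup _ hne fun u => hitVal F u l
  -- Since identifiers are below `n`, the quotient of the value by `n` decides the comparison, and
  -- its remainder names the maximizer.
  have hmax : ∀ u, load u ≤ load m := by
    intro u
    have h1 : hitVal F u l ≤ hitVal F m l := hm ▸ Finset.le_sup (f := fun u => hitVal F u l)
      (Finset.mem_univ u)
    rw [hval, hval] at h1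
    have h2 := m.isLt
    by_contra! hlt
    have := Nat.mul_le_mul_right n hlt
    rw [Nat.succ_mul] at this
    omega
  have hsum : h * U.card ≤ n * load m := by
    calc h * U.card = ∑ p ∈ U, h := by rw [Finset.sum_const, smul_eq_mul, mul_comm]
      _ ≤ ∑ p ∈ U, (F p.1 p.2).card :=
          Finset.sum_le_sum fun p hp => hF _ _ (mem_unhit.1 hp).1
      _ = ∑ p ∈ U, ∑ u, if u ∈ F p.1 p.2 then 1 else 0 := by simp
      _ = ∑ u, load u := by
          rw [Finset.sum_comm]
          refine Finset.sum_congr rfl fun u _ => ?_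
          rw [Finset.sum_boole, Nat.cast_id]
      _ ≤ ∑ _u : Fin n, load m := Finset.sum_le_sum fun u _ => hmax u
      _ = n * load m := by simp
  have hsub : unhit F (l ++ [Finset.univ.sup fun u => hitVal F u l]) ⊆
      U.filter fun p => m ∉ F p.1 p.2 := by
    intro p hp
    obtain ⟨h1, h2⟩ := mem_unhit.1 hp
    refine Finset.mem_filter.2 ⟨mem_unhit.2 ⟨h1, fun s hs hs' => h2 s hs ?_⟩, fun hmp => h2 m hmp ?_⟩
    · obtain ⟨a, ha, has⟩ := hs'
      exact ⟨a, List.mem_append_left _ ha, has⟩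
    · refine ⟨_, List.mem_append_right _ (List.mem_singleton.2 rfl), ?_⟩
      rw [hm, hval, mul_comm, Nat.mul_add_mod, Nat.mod_eq_of_lt m.isLt]
  have hcard := Finset.card_le_card hsub
  have hsplit := Finset.card_filter_add_card_filter_not (s := U) fun p => m ∈ F p.1 p.2
  change load m + _ = _ at hsplit
  have hsplit' := congrArg (n * ·) hsplit
  simp only [mul_add] at hsplit'
  refine (Nat.mul_le_mul_left n hcard).trans ?_
  rw [Nat.sub_mul]
  omega

/-- Greedy choices hit all sets of the family. -/
theorem exists_mem_picked {F : Fin n → Fin n → Finset (Fin n)} {h K : ℕ}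
    (hF : ∀ x y, (F x y).Nonempty → h ≤ (F x y).card) (hK : (n - h) ^ K * n ^ 2 < n ^ K)
    (x y : Fin n) (hxy : (F x y).Nonempty) :
    ∃ s ∈ picked n (supHistory (hitVal F) K), s ∈ F x y := by
  have key : ∀ k, n ^ k * (unhit F (supHistory (hitVal F) k)).card ≤ (n - h) ^ k * n ^ 2 := by
    intro k
    induction k with
    | zero =>
      rw [pow_zero, pow_zero, one_mul, one_mul]
      exact (Finset.card_le_univ _).trans (by simp [sq])
    | succ k ih =>
      calc n ^ (k + 1) * (unhit F (supHistory (hitVal F) (k + 1))).card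
          = n ^ k * (n * (unhit F (supHistory (hitVal F) (k + 1))).card) := by ring
        _ ≤ n ^ k * ((n - h) * (unhit F (supHistory (hitVal F) k)).card) :=
            Nat.mul_le_mul_left _ (unhit_card_le hF _)
        _ = (n - h) * (n ^ k * (unhit F (supHistory (hitVal F) k)).card) := by ring
        _ ≤ (n - h) * ((n - h) ^ k * n ^ 2) := Nat.mul_le_mul_left _ ih
        _ = _ := by ring
  by_contra! hno
  have hmem : (x, y) ∈ unhit F (supHistory (hitVal F) K) :=
    mem_unhit.2 ⟨hxy, fun s hs hs' => hno s hs' hs⟩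
  have := Nat.mul_le_mul_left (n ^ K) (Finset.card_pos.2 ⟨_, hmem⟩)
  have := key K
  omega

end HittingSet

/-! ### Greedy centers with disjoint balls -/

section Centers

variable {n : ℕ}

/-- The number `c + 1` stands for the node `c`, and `0` for none. -/
def decodeNode (n a : ℕ) : Option (Fin n) :=
  if h : 0 < a ∧ a - 1 < n then some ⟨a - 1, h.2⟩ else none

theorem decodeNode_succ (c : Fin n) : decodeNode n (c + 1) = some c := by
  simp [decodeNode]

open Classical in
/-- A node offers itself as a center if it is not near an earlier one. -/
noncomputable def centerVal (near : Fin n → Fin n → Prop) (u : Fin n) (l : List ℕ) : ℕ :=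
  if ∃ a ∈ l, ∃ c, decodeNode n a = some c ∧ near u c then 0 else u + 1

theorem centerVal_le (near : Fin n → Fin n → Prop) (u : Fin n) (l : List ℕ) :
    centerVal near u l ≤ n := by
  have := u.isLt
  unfold centerVal
  split_ifs <;> omega

theorem not_near_of_lt {near : Fin n → Fin n → Prop} {M j j' : ℕ} {c c' : Fin n} (hj : j < j')
    (hj' : j' < M)
    (hc : decodeNode n ((supHistory (centerVal near) M).getD j 0) = some c)
    (hc' : decodeNode n ((supHistory (centerVal near) M).getD j' 0) = some c') : ¬ near c' c := by
  classical
  intro hnear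
  rw [supHistory_getD _ hj'] at hc'
  obtain ⟨m, -, hm⟩ := Finset.exists_mem_eq_sup Finset.univ ⟨c, Finset.mem_univ c⟩
    fun v => centerVal near v (supHistory (centerVal near) j')
  rw [hm] at hc'
  unfold centerVal at hc'
  split_ifs at hc' with h
  · simp [decodeNode] at hc'
  · rw [decodeNode_succ] at hc'
    obtain rfl := Option.some.inj hc'
    refine h ⟨(supHistory (centerVal near) M).getD j 0, ?_, c, hc, hnear⟩
    rw [supHistory_getD _ (hj.trans hj'), supHistory_eq_map _ j', List.mem_map]
    exact ⟨j, List.mem_range.2 hj, rfl⟩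

/-- A node without a near center offers itself with a positive value each time, so no maximum is the
`0` that stands for no node. -/
theorem near_center_or {near : Fin n → Fin n → Prop} (M : ℕ) (u : Fin n) :
    (∃ j < M, ∃ c, decodeNode n ((supHistory (centerVal near) M).getD j 0) = some c ∧ near u c) ∨
    ∀ j < M, ∃ c, decodeNode n ((supHistory (centerVal near) M).getD j 0) = some c := by
  classical
  rw [or_iff_not_imp_left]
  intro hno j hj
  obtain ⟨m, -, hm⟩ := Finset.exists_mem_eq_sup Finset.univ ⟨u, Finset.mem_univ u⟩
    fun v => centerVal near v (supHistory (centerVal near) j)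
  have hu : centerVal near u (supHistory (centerVal near) j) = u + 1 := by
    refine if_neg ?_
    rintro ⟨a, ha, c, hc, hnear⟩
    rw [supHistory_eq_map, List.mem_map] at ha
    obtain ⟨i, hi, rfl⟩ := ha
    rw [List.mem_range] at hi
    exact hno ⟨i, hi.trans hj, c, by rw [supHistory_getD _ (hi.trans hj)]; exact hc, hnear⟩
  have hle := Finset.le_sup (f := fun v => centerVal near v (supHistory (centerVal near) j))
    (Finset.mem_univ u)
  rw [hm, hu] at hle
  rw [supHistory_getD _ hj, hm]
  refine ⟨m, ?_⟩
  unfold centerVal at hle ⊢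
  split_ifs at hle ⊢ with h
  · omega
  · exact decodeNode_succ m

end Centers

namespace Network

variable {n W : ℕ} (N : Network n W)

/-- The nodes at distance at most `h` from `u`, with respect to the number of edges. -/
noncomputable def ball (h : ℕ) (u : Fin n) : Finset (Fin n) :=
  Finset.univ.filter fun v => N.graph.dist u v ≤ h

theorem mem_ball {h : ℕ} {u v : Fin n} : v ∈ N.ball h u ↔ N.graph.dist u v ≤ h := by
  simp [ball]

/-- Either the ball is the whole graph, or a shortest path leaves it and contributes its first `h +
1` nodes. -/
theorem lt_card_ball {h : ℕ} (hn : h < n) (u : Fin n) : h < (N.ball h u).card := by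
  by_cases hall : ∀ v, N.graph.dist u v ≤ h
  · have : N.ball h u = Finset.univ := Finset.filter_true_of_mem fun v _ => hall v
    rw [this, Finset.card_univ, Fintype.card_fin]
    exact hn
  · push Not at hall
    obtain ⟨v, hv⟩ := hall
    obtain ⟨P, hP⟩ := N.connected.exists_walk_length_eq_dist u v
    have hPp := P.isPath_of_length_eq_dist hP
    have := Finset.card_le_card_of_injOn (s := Finset.range (h + 1)) (t := N.ball h u) P.getVert
      (fun i hi => by
        have hi' := Finset.mem_range.1 (Finset.mem_coe.1 hi)
        refine Finset.mem_coe.2 (N.mem_ball.2 ((SimpleGraph.dist_le (P.take i)).trans ?_))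
        rw [SimpleGraph.Walk.take_length]
        omega)
      (hPp.getVert_injOn.mono fun i hi => by
        have hi' := Finset.mem_range.1 (Finset.mem_coe.1 hi)
        simp only [Set.mem_ofPred_eq]
        omega)
    rw [Finset.card_range] at this
    omega

/-- The list of the greedily chosen centers: they are more than `2 * h` apart. -/
noncomputable def centers (h M : ℕ) : List ℕ :=
  supHistory (centerVal fun u c => N.graph.dist u c ≤ 2 * h) M

/-- The `j`-th center. -/
noncomputable def center (h M j : ℕ) : Option (Fin n) := decodeNode n ((N.centers h M).getD j 0)

theorem center_inj {h M j j' : ℕ} (hj : j < M) (hj' : j' < M) {c c' b : Fin n}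
    (hc : N.center h M j = some c) (hc' : N.center h M j' = some c') (hb : b ∈ N.ball h c)
    (hb' : b ∈ N.ball h c') : j = j' := by
  rw [mem_ball] at hb hb'
  have h1 : N.graph.dist c c' ≤ 2 * h := by
    have := N.connected.dist_triangle (u := c) (v := b) (w := c')
    rw [SimpleGraph.dist_comm (u := b)] at this
    omega
  obtain hlt | heq | hlt := lt_trichotomy j j'
  · exact absurd (SimpleGraph.dist_comm (G := N.graph) (u := c) ▸ h1) (not_near_of_lt hlt hj' hc hc')
  · exact heq
  · exact absurd h1 (not_near_of_lt hlt hj hc' hc)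

/-- Otherwise all `M` choices yield centers, whose disjoint balls would contain `M * (h + 1) > n`
nodes. -/
theorem exists_center_near {h M : ℕ} (hn : h < n) (hM : n < M * (h + 1)) (u : Fin n) :
    ∃ j < M, ∃ c, N.center h M j = some c ∧ N.graph.dist u c ≤ 2 * h := by
  refine (near_center_or M u).resolve_right fun hall => ?_
  have : Nonempty (Fin n) := ⟨u⟩
  choose! c hc using hall
  have hdisj : (Finset.range M : Set ℕ).PairwiseDisjoint fun j => N.ball h (c j) := by
    intro j hj j' hj' hne
    rw [Finset.coe_range, Set.mem_Iio] at hj hj'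
    refine Finset.disjoint_left.2 fun b hb hb' => hne ?_
    exact N.center_inj hj hj' (hc j hj) (hc j' hj') hb hb'
  have h1 := Finset.card_biUnion hdisj
  have h2 : ((Finset.range M).biUnion fun j => N.ball h (c j)).card ≤ n :=
    (Finset.card_le_univ _).trans (by simp)
  have h3 : ∑ _j ∈ Finset.range M, (h + 1) ≤ ∑ j ∈ Finset.range M, (N.ball h (c j)).card :=
    Finset.sum_le_sum fun j _ => N.lt_card_ball hn (c j)
  rw [Finset.sum_const, Finset.card_range, smul_eq_mul] at h3
  omega

end Network

/-! ### Introductions and reports -/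

/-- What a node computes from the topology of its surroundings: its hop-limited distances to all
nodes, its critical sets, and the nodes that are near. -/
structure Surroundings (n : ℕ) where
  row : Fin n → ℕ∞
  critical : Fin n → Finset (Fin n)
  ball : Finset (Fin n)

/-- The knowledge of a node when the routing of the distances starts: the surroundings of the nodes
near it, the list of centers, and the list of nodes that hit the critical sets. -/
structure Overview (n : ℕ) where
  near : Fin n → Option (Surroundings n)
  centers : List ℕ
  hitters : List ℕ

/-- In slot `j * M + l`, the member of rank `i < q` of the ball around the `j`-th center introduces
itself to node `i + q * l`. -/
noncomputable def introduction {n : ℕ} (M q t : ℕ) (u : Fin n) (x : Overview n) :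
    Option (Fin n × ℕ) :=
  (decodeNode n (x.centers.getD (t / M) 0)).bind fun c => (x.near c).bind fun d =>
    if h : u ∈ d.ball ∧ d.ball.toList.idxOf u < q ∧ d.ball.toList.idxOf u + q * (t % M) < n then
      some (⟨_, h.2.2⟩, u) else none

/-- In slot `j * K + k`, node `v` sends its hop-limited distance to the `k`-th hitter to the node
that has introduced itself to `v` from the ball with index `v / q + j` modulo `M`. -/
noncomputable def report {n : ℕ} (M q K t : ℕ) (v : Fin n) (x : Overview n × (ℕ → Option ℕ)) :
    Option (Fin n × ℕ) :=
  (x.2 ((v / q + t / K) % M * M + v / q)).bind fun b => (x.1.near v).bind fun d =>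
    if h : b < n ∧ 0 < n ∧ d.row ⟨x.1.hitters.getD (t % K) 0 % n, Nat.mod_lt _ v.pos⟩ ≠ ⊤ then
      some (⟨b, h.1⟩, Nat.pair v (Nat.pair (x.1.hitters.getD (t % K) 0 % n)
        (d.row ⟨x.1.hitters.getD (t % K) 0 % n, Nat.mod_lt _ v.pos⟩).toNat))
    else none

namespace Network

variable {n W : ℕ} (N : Network n W) (h M K : ℕ)

/-- The true surroundings of `u`. -/
noncomputable def surroundings (u : Fin n) : Surroundings n :=
  ⟨hopDist N.view h u, _root_.critical N.view h u, N.ball h u⟩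

/-- The true overview of `u`. -/
noncomputable def overview (u : Fin n) : Overview n where
  near v := if N.graph.dist u v ≤ 2 * h then some (N.surroundings h v) else none
  centers := N.centers h M
  hitters := supHistory (hitVal (_root_.critical N.view h)) K

/-- The introductions that `u` receives. -/
noncomputable def introductions (u : Fin n) (t : ℕ) : Option ℕ :=
  if t < M * M then received (fun v => introduction M (h + 1) t v (N.overview h M K v)) u else none

/-- The reports that `u` receives. -/
noncomputable def reports (u : Fin n) (t : ℕ) : Option ℕ :=
  if t < M * K then received (fun v => report M (h + 1) K t v
    (N.overview h M K v, N.introductions h M K v)) u else none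

theorem introduction_eq_some {t : ℕ} {u v : Fin n} {m : ℕ} :
    introduction M (h + 1) t u (N.overview h M K u) = some (v, m) ↔
      ∃ c, N.center h M (t / M) = some c ∧ u ∈ N.ball h c ∧
        (N.ball h c).toList.idxOf u < h + 1 ∧
        (N.ball h c).toList.idxOf u + (h + 1) * (t % M) = v ∧ m = u := by
  unfold introduction
  simp only [Option.bind_eq_some_iff]
  refine exists_congr fun c => and_congr_right fun hc => ?_
  simp only [overview]
  constructor
  · rintro ⟨d, hd, hm⟩
    split_ifs at hd
    obtain rfl := Option.some.inj hd
    split_ifs at hm with hu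
    simp only [Option.some.injEq, Prod.mk.injEq] at hm
    exact ⟨hu.1, hu.2.1, congrArg Fin.val hm.1, hm.2.symm⟩
  · rintro ⟨h1, h2, h3, rfl⟩
    refine ⟨N.surroundings h c, if_pos ?_, ?_⟩
    · have := N.mem_ball.1 h1
      rw [SimpleGraph.dist_comm]
      omega
    · have h4 : u ∈ (N.surroundings h c).ball ∧ (N.surroundings h c).ball.toList.idxOf u < h + 1 ∧
          (N.surroundings h c).ball.toList.idxOf u + (h + 1) * (t % M) < n :=
        ⟨h1, h2, h3.trans_lt v.isLt⟩
      rw [dif_pos h4]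
      exact congrArg some (Prod.ext (Fin.ext h3) rfl)

/-- A slot serves a single center, and the recipient together with the slot determines the rank of
the sender in its ball. -/
theorem collisionFree_introduction (t : ℕ) :
    CollisionFree fun v => introduction M (h + 1) t v (N.overview h M K v) := by
  intro u v v' m m' hv hv'
  obtain ⟨c, hc, h1, h2, h3, -⟩ := (N.introduction_eq_some h M K).1 hv
  obtain ⟨c', hc', h1', h2', h3', -⟩ := (N.introduction_eq_some h M K).1 hv'
  obtain rfl := Option.some.inj (hc.symm.trans hc')
  exact (List.idxOf_inj (Finset.mem_toList.2 h1)).1 (by omega)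

theorem introductions_eq_some {j : ℕ} (hj : j < M) (hM : n < M * (h + 1)) {v : Fin n} {b : ℕ} :
    N.introductions h M K v (j * M + v / (h + 1)) = some b ↔
      ∃ (u c : Fin n), b = u ∧ N.center h M j = some c ∧ u ∈ N.ball h c ∧
        (N.ball h c).toList.idxOf u = v % (h + 1) := by
  have hv : v / (h + 1) < M := by
    rw [Nat.div_lt_iff_lt_mul (Nat.succ_pos h)]
    exact v.isLt.trans hM
  have hlt : j * M + v / (h + 1) < M * M := by
    have := Nat.mul_le_mul_right M (Nat.succ_le_of_lt hj)
    rw [Nat.succ_mul] at this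
    omega
  have hdiv : (j * M + v / (h + 1)) / M = j := by
    rw [mul_comm, Nat.mul_add_div (by omega), Nat.div_eq_of_lt hv, add_zero]
  have hmod : (j * M + v / (h + 1)) % M = v / (h + 1) := by
    rw [mul_comm, Nat.mul_add_mod, Nat.mod_eq_of_lt hv]
  rw [introductions, if_pos hlt, received_eq_some (N.collisionFree_introduction h M K _)]
  refine exists_congr fun u => ?_
  rw [introduction_eq_some, hdiv, hmod]
  have h1 := Nat.mod_add_div v (h + 1)
  have h2 : v.val % (h + 1) < h + 1 := Nat.mod_lt _ (Nat.succ_pos h)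
  constructor
  · rintro ⟨c, hc, h3, h4, h5, h6⟩
    exact ⟨c, h6, hc, h3, by omega⟩
  · rintro ⟨c, h6, hc, h3, h4⟩
    exact ⟨c, hc, h3, by omega, by omega, h6⟩

theorem report_eq_some {t : ℕ} {v b : Fin n} {m : ℕ} :
    report M (h + 1) K t v (N.overview h M K v, N.introductions h M K v) = some (b, m) ↔
      N.introductions h M K v ((v / (h + 1) + t / K) % M * M + v / (h + 1)) = some b.val ∧
      ∃ (s : Fin n) (c : ℕ), s.val = (N.overview h M K v).hitters.getD (t % K) 0 % n ∧
        hopDist N.view h v s = c ∧ m = Nat.pair v (Nat.pair s c) := by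
  have hnear : (N.overview h M K v).near v = some (N.surroundings h v) := by simp [overview]
  unfold report
  simp only [Option.bind_eq_some_iff, hnear, Option.some.injEq, exists_eq_left']
  constructor
  · rintro ⟨b', hb', hm⟩
    split_ifs at hm with hcond
    simp only [Option.some.injEq, Prod.mk.injEq] at hm
    obtain ⟨rfl, rfl⟩ := hm
    exact ⟨hb', _, _, rfl, (ENat.natCast_toNat hcond.2.2).symm, rfl⟩
  · rintro ⟨hb, s, c, hs, hc, rfl⟩
    refine ⟨b, hb, ?_⟩
    have hrow : (N.surroundings h v).row s = c := hc
    simp only [hrow, ← hs]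
    rw [dif_pos ⟨b.isLt, v.pos, ENat.natCast_ne_top c⟩]
    rfl

/-- The recipient lies in only one ball, and its rank there is the residue of the sender modulo `h +
1`. Senders with equal residues differ in their quotients, and the rotation by `v / (h + 1)` directs
these to different balls in the same slot. -/
theorem collisionFree_report (hM : n < M * (h + 1)) (t : ℕ) :
    CollisionFree fun v => report M (h + 1) K t v
      (N.overview h M K v, N.introductions h M K v) := by
  intro b v v' m m' hv hv'
  have hM0 : 0 < M := Nat.pos_of_ne_zero (by rintro rfl; simp at hM)
  have hdiv : ∀ v : Fin n, v / (h + 1) < M := fun v => by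
    rw [Nat.div_lt_iff_lt_mul (Nat.succ_pos h)]
    exact v.isLt.trans hM
  obtain ⟨u, c, hu, hc, h1, h2⟩ := (N.introductions_eq_some h M K (Nat.mod_lt _ hM0) hM).1
    ((N.report_eq_some h M K).1 hv).1
  obtain ⟨u', c', hu', hc', h1', h2'⟩ := (N.introductions_eq_some h M K (Nat.mod_lt _ hM0) hM).1
    ((N.report_eq_some h M K).1 hv').1
  obtain rfl := Fin.ext hu
  obtain rfl := Fin.ext hu'
  have hj := N.center_inj (Nat.mod_lt _ hM0) (Nat.mod_lt _ hM0) hc hc' h1 h1'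
  rw [hj] at hc
  obtain rfl := Option.some.inj (hc.symm.trans hc')
  have hq : v.val / (h + 1) = v'.val / (h + 1) := by
    have := Nat.ModEq.add_right_cancel' (t / K) (show _ ≡ _ [MOD M] from hj)
    exact Nat.ModEq.eq_of_lt_of_lt this (hdiv v) (hdiv v')
  have h3 := Nat.mod_add_div v (h + 1)
  have h4 := Nat.mod_add_div v' (h + 1)
  rw [hq] at h3
  exact Fin.ext (by omega)

variable {h M K}

theorem eq_of_reports_eq_some (hM : n < M * (h + 1)) {z x y : Fin n} {t c : ℕ}
    (hr : N.reports h M K z t = some (Nat.pair x (Nat.pair y c))) :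
    hopDist N.view h x y = c := by
  unfold reports at hr
  split_ifs at hr
  obtain ⟨v, hv⟩ := (received_eq_some (N.collisionFree_report h M K hM t)).1 hr
  obtain ⟨-, s, c', -, hc, hm⟩ := (N.report_eq_some h M K).1 hv
  rw [Nat.pair_eq_pair, Nat.pair_eq_pair] at hm
  obtain ⟨h1, h2, rfl⟩ := hm
  rw [Fin.ext h1, Fin.ext h2, hc]

/-- Every node is near a node that has received a given report. -/
theorem exists_reports_eq_some (hn : h < n) (hM : n < M * (h + 1)) (u y : Fin n) {s : Fin n} {c : ℕ}
    (hs : s ∈ picked n (supHistory (hitVal (_root_.critical N.view h)) K))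
    (hc : hopDist N.view h y s = c) :
    ∃ z t, N.graph.dist u z ≤ 3 * h ∧
      N.reports h M K z t = some (Nat.pair y (Nat.pair s c)) := by
  obtain ⟨a, ha, has⟩ := hs
  obtain ⟨k, hk, rfl⟩ := List.mem_iff_getElem.1 ha
  have hlen : k < K := by
    have := hk
    rwa [supHistory_eq_map, List.length_map, List.length_range] at this
  obtain ⟨j, hj, p, hp, hup⟩ := N.exists_center_near hn hM u
  have hdiv : y.val / (h + 1) < M := by
    rw [Nat.div_lt_iff_lt_mul (Nat.succ_pos h)]
    exact y.isLt.trans hM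
  have hrank : y.val % (h + 1) < (N.ball h p).toList.length := by
    rw [Finset.length_toList]
    exact (Nat.mod_lt _ (Nat.succ_pos h)).trans_le (N.lt_card_ball hn p)
  -- The member of the ball near `u` that is responsible for `y`; balls have more than `h` members,
  -- so every residue is served.
  set b := (N.ball h p).toList[y.val % (h + 1)] with hb
  have hbp : b ∈ N.ball h p := Finset.mem_toList.1 (List.getElem_mem hrank)
  have hidx : (N.ball h p).toList.idxOf b = y % (h + 1) :=
    (Finset.nodup_toList _).idxOf_getElem _ hrank
  have hub := N.connected.dist_triangle (u := u) (v := p) (w := b)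
  have hpb := N.mem_ball.1 hbp
  -- The offset at which the rotation brings `y` to the ball with index `j`.
  obtain ⟨j', hj', hjj⟩ : ∃ j' < M, (y.val / (h + 1) + j') % M = j := by
    generalize y.val / (h + 1) = q at hdiv
    by_cases hle : q ≤ j
    · exact ⟨j - q, by omega, by rw [Nat.add_sub_cancel' hle, Nat.mod_eq_of_lt hj]⟩
    · refine ⟨j + M - q, by omega, ?_⟩
      rw [Nat.add_sub_cancel' (by omega), Nat.add_mod_right, Nat.mod_eq_of_lt hj]
  have hK : 0 < K := by omega
  have hdivK : (j' * K + k) / K = j' := by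
    rw [mul_comm, Nat.mul_add_div hK, Nat.div_eq_of_lt hlen, add_zero]
  have hmodK : (j' * K + k) % K = k := by
    rw [mul_comm, Nat.mul_add_mod, Nat.mod_eq_of_lt hlen]
  refine ⟨b, j' * K + k, by omega, ?_⟩
  have hlt : j' * K + k < M * K := by
    have := Nat.mul_le_mul_right K (Nat.succ_le_of_lt hj')
    rw [Nat.succ_mul] at this
    omega
  unfold reports
  rw [if_pos hlt, received_eq_some (N.collisionFree_report h M K hM _)]
  refine ⟨y, (N.report_eq_some h M K).2 ⟨?_, s, c, ?_, hc, rfl⟩⟩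
  · rw [hdivK, hjj]
    exact (N.introductions_eq_some h M K hj hM).2 ⟨b, p, rfl, hp, hbp, hidx⟩
  · rw [hmodK, ← has]
    simp only [overview, List.getD, List.getElem?_eq_getElem hk, Option.getD_some]

end Network

/-! ### The algorithm and its number of rounds -/

section Algorithm

variable {n W γ B : ℕ}

theorem learns_surroundings (hγ : 0 < γ) (h : ℕ) :
    Learns γ B (3 * h) fun (N : Network n W) u => N.surroundings h u := by
  have h1 := (Learns.start (n := n) (W := W) (γ := γ) (B := B)).flood hγ h
  -- The first `h` rounds serve to find the ball; `2 * h` rounds bring the views that critical sets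
  -- require.
  have h2 := (h1.map fun u κ => ((κ u).getD fun _ => none,
    Finset.univ.filter fun v => (κ v).isSome)).flood hγ (2 * h)
  refine (h2.map fun u κ => (⟨hopDist (fun z => (κ z).elim (fun _ => none) Prod.fst) h u,
    critical (fun z => (κ z).elim (fun _ => none) Prod.fst) h u,
    (κ u).elim ∅ Prod.snd⟩ : Surroundings n)).of_eq (by ring) fun N u => ?_
  have key : ∀ z, N.graph.dist u z ≤ 2 * h →
      (Option.elim (if N.graph.dist u z ≤ 2 * h then
        some ((if N.graph.dist z z ≤ h then
            some (HybridAlgorithm.localView N.graph N.weight z) else none).getD fun _ => none,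
          Finset.univ.filter fun v => (if N.graph.dist z v ≤ h then
            some (HybridAlgorithm.localView N.graph N.weight v) else none).isSome) else none)
        (fun _ => none) Prod.fst) = N.view z := by
    intro z hz
    rw [if_pos hz]
    simp [Network.view]
  unfold Network.surroundings
  congr 1
  · funext y
    exact N.hopDist_congr (fun z hz => key z (by omega)) y
  · funext y
    exact N.critical_congr key y
  · simp only [SimpleGraph.dist_self, Nat.zero_le, if_true, Option.elim_some]
    ext v
    simp [Network.mem_ball]

theorem learns_overview (hγ : 0 < γ) (h M K : ℕ) (hB : n ^ 3 + n < 2 ^ B) :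
    Learns γ B (5 * h + (M + K) * Nat.clog 2 n)
      fun (N : Network n W) u => N.overview h M K u := by
  have h1 := (learns_surroundings (n := n) (W := W) (B := B) hγ h).flood hγ (2 * h)
  have h2 := h1.supHistory hγ
    -- Having heard from `c` in the flood is the same as being within `2 * h` hops of `c`.
    (fun u κ => centerVal (fun _ c => (κ c).isSome) u)
    (fun N v l => (centerVal_le _ v l).trans_lt (by omega)) M
  have h3 := h2.supHistory hγ
    (fun u κ => hitVal (fun x => (κ.1 x).elim (fun _ => ∅) Surroundings.critical) u)
    (fun N v l => (hitVal_lt _ v l).trans hB) K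
  refine (h3.map fun u κ => (⟨κ.1.1, κ.1.2, κ.2⟩ : Overview n)).of_eq (by ring) fun N u => ?_
  unfold Network.overview
  congr 1
  · unfold Network.centers
    change supHistory _ M = supHistory _ M
    congr 1
    funext v l
    simp [centerVal]
  · change supHistory _ K = supHistory _ K
    congr 1
    funext v l
    refine hitVal_congr (fun x y hv => ?_) (fun x y hv => ?_) l
    · have := N.dist_le_of_mem_critical hv
      rw [SimpleGraph.dist_comm] at this
      simp only
      rw [if_pos (by omega)]
      rfl
    · simp only at hv ⊢
      split_ifs at hv ⊢
      · rfl
      · exact absurd hv (by simp)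

theorem learns_reports (hγ : 0 < γ) (h M K : ℕ) (hM : n < M * (h + 1)) (hB : n ^ 3 + n < 2 ^ B)
    (hB' : ∀ v < n, ∀ s < n, ∀ c ≤ h * W, Nat.pair v (Nat.pair s c) < 2 ^ B) :
    Learns γ B (5 * h + (M + K) * Nat.clog 2 n + M * M + M * K)
      fun (N : Network n W) u => (N.surroundings h u, N.overview h M K u, N.reports h M K u) := by
  have h1 := (learns_overview (n := n) (W := W) hγ h M K hB).schedule hγ (M * M)
    (introduction M (h + 1)) (fun t N v u m hm => by
      obtain ⟨-, -, -, -, -, rfl⟩ := (N.introduction_eq_some h M K).1 hm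
      have := v.isLt
      omega) fun t N => N.collisionFree_introduction h M K t
  have h2 := h1.schedule hγ (M * K) (report M (h + 1) K) (fun t N v u m hm => by
      obtain ⟨-, s, c, -, hc, rfl⟩ := (N.report_eq_some h M K).1 hm
      refine hB' _ v.isLt _ s.isLt c ?_
      have := N.hopDist_le_mul (k := h) (x := v) (y := s) (by simp [hc])
      rw [hc] at this
      exact_mod_cast this) fun t N => N.collisionFree_report h M K hM t
  refine (h2.map fun u x => ((x.1.1.near u).getD ⟨fun _ => ⊤, fun _ => ∅, ∅⟩, x.1.1, x.2)).of_eq rfl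
    fun N u => Prod.ext ?_ rfl
  simp [Network.overview]

/-- A node computes distances from its own hop-limited distances and from reports. -/
theorem learns_weightedDist (hγ : 0 < γ) (h M K : ℕ) (hh : 0 < h) (hn : h < n)
    (hM : n < M * (h + 1)) (hK : (n - h) ^ K * n ^ 2 < n ^ K) (hB : n ^ 3 + n < 2 ^ B)
    (hB' : ∀ v < n, ∀ s < n, ∀ c ≤ h * W, Nat.pair v (Nat.pair s c) < 2 ^ B) :
    Learns γ B (8 * h + (M + K) * Nat.clog 2 n + M * M + M * K)
      fun (N : Network n W) u v => (weightedDist N.graph N.weight u v).toNat := by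
  have h1 := (learns_reports (n := n) (W := W) hγ h M K hM hB hB').flood hγ (3 * h)
  let E : Fin n → (Fin n → Option (Surroundings n × Overview n × (ℕ → Option ℕ))) →
      Fin n → Fin n → ℕ → Prop := fun u κ x y c =>
    (x = u ∧ ∃ d, κ u = some d ∧ d.1.row y = c) ∨
    ∃ z d t, κ z = some d ∧ (d.2.2 t = some (Nat.pair x (Nat.pair y c)) ∨
      d.2.2 t = some (Nat.pair y (Nat.pair x c)))
  -- All legs known to `u` are true hop-limited distances, so no route is shorter than the distance;
  -- it remains to see that some route attains it.
  refine (h1.map fun u κ v => sInf {c | Route (E u κ) u v c}).of_eq (by ring) fun N u => ?_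
  funext v
  set κ : Fin n → Option (Surroundings n × Overview n × (ℕ → Option ℕ)) :=
    fun v => if N.graph.dist u v ≤ 3 * h then
      some (N.surroundings h v, N.overview h M K v, N.reports h M K v) else none with hκ
  have hκs : ∀ z d, κ z = some d →
      d = (N.surroundings h z, N.overview h M K z, N.reports h M K z) := by
    intro z d hd
    simp only [hκ] at hd
    split_ifs at hd
    exact (Option.some.inj hd).symm
  have hsound : ∀ x y c, E u κ x y c → hopDist N.view h x y = c := by
    rintro x y c (⟨rfl, d, hd, hc⟩ | ⟨z, d, t, hd, hr | hr⟩)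
    · rw [hκs _ _ hd] at hc
      exact hc
    · rw [hκs _ _ hd] at hr
      exact N.eq_of_reports_eq_some hM hr
    · rw [hκs _ _ hd] at hr
      rw [N.hopDist_symm]
      exact N.eq_of_reports_eq_some hM hr
  set S := picked n (supHistory (hitVal (critical N.view h)) K) with hS
  have hcard : ∀ x y, (critical N.view h x y).Nonempty → h ≤ (critical N.view h x y).card := by
    rintro x y ⟨s, hs⟩
    exact N.le_card_critical (Network.mem_critical.1 hs).1
  -- Legs from `u` come from its own row. Legs from a hitter come from reports, read backwards by
  -- the symmetry of hop-limited distances.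
  obtain ⟨c, hc, hroute⟩ := N.exists_route (E := E u κ) hh (A := insert u S) (S := S)
    (Set.subset_insert u S) (by
      rintro x (rfl | hx) y c hxy
      · exact Or.inl ⟨rfl, _, if_pos (by simp), hxy⟩
      · obtain ⟨z, t, hz, hr⟩ := N.exists_reports_eq_some hn hM u y hx
          ((N.hopDist_symm h y x).trans hxy)
        exact Or.inr ⟨z, _, t, if_pos hz, Or.inr hr⟩)
    (exists_mem_picked hcard hK) (y := v) (Set.mem_insert u S)
  rw [← hc, ENat.toNat_natCast]
  refine le_antisymm (Nat.sInf_le hroute) (le_csInf ⟨c, hroute⟩ fun c' hc' => ?_)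
  have := N.weightedDist_le_of_route hsound hc'
  rw [← hc] at this
  exact_mod_cast this

/-- What nodes learn in the full-information model can be output in the hybrid network model. -/
theorem Learns.exists_algorithm {T : ℕ}
    (hf : Learns γ B T fun (N : Network n W) u v => (weightedDist N.graph N.weight u v).toNat) :
    ∃ A : HybridAlgorithm n γ B, ∀ (G : SimpleGraph (Fin n)) (w : Sym2 (Fin n) → ℕ),
      G.Connected → (∀ e ∈ G.edgeSet, w e ≤ W) →
      A.seedProb {r | A.SolvesAPSPWithSeeds T G w r} = 1 := by
  obtain ⟨send, read, h⟩ := hf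
  refine ⟨fullInfo γ send read, fun G w hG hw => ?_⟩
  have huniv : {r | (fullInfo γ send read).SolvesAPSPWithSeeds T G w r} = Set.univ := by
    refine Set.eq_univ_of_forall fun r σ hσ u v => ?_
    have := h ⟨G, w, hG, hw⟩ σ ⟨hσ.1, fun t _ u => hσ.2 t u⟩ u
    change ((read (σ T u) v : ℕ) : ℕ∞) = _
    rw [this]
    exact ENat.natCast_toNat (Network.weightedDist_ne_top ⟨G, w, hG, hw⟩ u v)
  rw [HybridAlgorithm.seedProb, huniv, Set.ncard_univ]
  have : Nat.card (Fin n → (fullInfo γ send read).Seed) = 1 := by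
    change Nat.card (Fin n → Unit) = 1
    simp
  rw [this]
  simp

end Algorithm

/-! ### Choice of parameters -/

section Parameters

theorem pow_le_two_pow_mul_clog (n β : ℕ) : n ^ β ≤ 2 ^ (β * Nat.clog 2 n) := by
  rw [mul_comm, pow_mul]
  exact Nat.pow_le_pow_left (Nat.le_pow_clog one_lt_two n) β

/-- Each pairing at most squares the bound, so the exponent `a + 2` is doubled twice. -/
theorem pair_pair_lt {n a v s c : ℕ} (hn : 2 ≤ n) (hv : v < n) (hs : s < n) (hc : c ≤ n * n ^ a) :
    Nat.pair v (Nat.pair s c) < n ^ (4 * a + 8) := by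
  have h1 : n ≤ n * n ^ a := Nat.le_mul_of_pos_right n (by positivity)
  have h2 : n * n ^ a + 1 ≤ n ^ (a + 2) := by
    have := Nat.mul_le_mul_right (n * n ^ a) hn
    rw [show n ^ (a + 2) = n * (n * n ^ a) by ring]
    omega
  have h3 : Nat.pair s c < n ^ (2 * a + 4) :=
    calc Nat.pair s c < (max s c + 1) ^ 2 := Nat.pair_lt_max_add_one_sq s c
      _ ≤ (n ^ (a + 2)) ^ 2 := Nat.pow_le_pow_left (by omega) 2
      _ = n ^ (2 * a + 4) := by ring
  have h4 : n ≤ n ^ (2 * a + 4) := Nat.le_self_pow (by omega) n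
  calc Nat.pair v (Nat.pair s c) < (max v (Nat.pair s c) + 1) ^ 2 := Nat.pair_lt_max_add_one_sq _ _
    _ ≤ (n ^ (2 * a + 4)) ^ 2 := Nat.pow_le_pow_left (by omega) 2
    _ = n ^ (4 * a + 8) := by ring

theorem clog_le_three_mul_log {n : ℕ} (hn : 3 ≤ n) : (Nat.clog 2 n : ℝ) ≤ 3 * Real.log n := by
  have hlog : 1 ≤ Real.log n := by
    rw [Real.le_log_iff_exp_le (by positivity)]
    have : (3 : ℝ) ≤ n := by exact_mod_cast hn
    linarith [Real.exp_one_lt_d9]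
  have h1 : 2 ^ (Nat.clog 2 n - 1) < n := Nat.pow_pred_clog_lt_self one_lt_two (by omega)
  have h2 : ((Nat.clog 2 n - 1 : ℕ) : ℝ) * Real.log 2 ≤ Real.log n := by
    rw [← Real.log_pow]
    exact Real.log_le_log (by positivity) (by exact_mod_cast h1.le)
  have h3 : (Nat.clog 2 n : ℝ) ≤ ((Nat.clog 2 n - 1 : ℕ) : ℝ) + 1 := by
    exact_mod_cast (by omega : Nat.clog 2 n ≤ Nat.clog 2 n - 1 + 1)
  have h4 := Real.log_two_gt_d9
  have h5 : (0 : ℝ) ≤ ((Nat.clog 2 n - 1 : ℕ) : ℝ) := Nat.cast_nonneg _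
  nlinarith

/-- From 1 - h/n ≤ exp(-h/n), the K-th power is at most n^(-3), which beats the n² sets to be hit.
-/
theorem sub_pow_mul_sq_lt_pow {n h K : ℕ} (hn : 2 ≤ n) (hh : h ≤ n)
    (hK : 3 * (n : ℝ) * Real.log n ≤ h * K) : (n - h) ^ K * n ^ 2 < n ^ K := by
  have hn' : (2 : ℝ) ≤ n := by exact_mod_cast hn
  have hpos : (0 : ℝ) < n := by linarith
  have h1 : ((n - h : ℕ) : ℝ) ≤ n * Real.exp (-(h / n)) := by
    rw [Nat.cast_sub hh]
    have := Real.add_one_le_exp (-((h : ℝ) / n))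
    calc (n : ℝ) - h = n * (-((h : ℝ) / n) + 1) := by field_simp; ring
      _ ≤ _ := by gcongr
  have h2 : ((n - h : ℕ) : ℝ) ^ K ≤ n ^ K * Real.exp (-(3 * Real.log n)) := by
    calc ((n - h : ℕ) : ℝ) ^ K ≤ (n * Real.exp (-(h / n))) ^ K := by gcongr
      _ = n ^ K * Real.exp (-(h * K / n)) := by
          rw [mul_pow, ← Real.exp_nat_mul]
          congr 2
          ring
      _ ≤ _ := by
          gcongr
          rw [le_div_iff₀ hpos]
          linarith
  have h3 : Real.exp (-(3 * Real.log n)) = ((n : ℝ) ^ 3)⁻¹ := by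
    rw [Real.exp_neg, mul_comm, Real.exp_mul, Real.exp_log hpos]
    norm_cast
  have h4 : ((n - h : ℕ) : ℝ) ^ K * (n : ℝ) ^ 2 < (n : ℝ) ^ K := by
    calc ((n - h : ℕ) : ℝ) ^ K * (n : ℝ) ^ 2 ≤ n ^ K * ((n : ℝ) ^ 3)⁻¹ * (n : ℝ) ^ 2 := by
          rw [← h3]; gcongr
      _ = n ^ K * (n : ℝ)⁻¹ := by field_simp
      _ < n ^ K * 1 := by
          gcongr
          exact inv_lt_one_of_one_lt₀ (by linarith)
      _ = _ := mul_one _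
  exact_mod_cast h4

theorem exists_parameters {n : ℕ} (hn : 27 ≤ n) : ∃ h M K : ℕ, 0 < h ∧ h < n ∧ n < M * (h + 1) ∧
    (n - h) ^ K * n ^ 2 < n ^ K ∧
    ((8 * h + (M + K) * Nat.clog 2 n + M * M + M * K : ℕ) : ℝ) ≤
      46 * (n : ℝ) ^ (2 / 3 : ℝ) * Real.log n ^ 2 := by
  have hn' : (27 : ℝ) ≤ n := by exact_mod_cast hn
  have hpos : (0 : ℝ) < n := by linarith
  set x : ℝ := (n : ℝ) ^ (1 / 3 : ℝ) with hx
  set L := Real.log n with hL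
  have hx3 : x ^ 3 = n := by
    rw [hx, ← Real.rpow_natCast, ← Real.rpow_mul hpos.le]
    norm_num
  have hx2 : (n : ℝ) ^ (2 / 3 : ℝ) = x ^ 2 := by
    rw [hx, ← Real.rpow_natCast, ← Real.rpow_mul hpos.le]
    norm_num
  have hx0 : 0 < x := Real.rpow_pos_of_pos hpos _
  have hx3' : 3 ≤ x := by
    by_contra! hlt
    have : x ^ 3 < 3 ^ 3 := by gcongr
    linarith
  have hL1 : 1 ≤ L := by
    rw [hL, Real.le_log_iff_exp_le hpos]
    linarith [Real.exp_one_lt_d9]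
  have hclog : (Nat.clog 2 n : ℝ) ≤ 3 * L := clog_le_three_mul_log (by omega)
  have hh1 : x ^ 2 ≤ ⌈x ^ 2⌉₊ := Nat.le_ceil _
  have hh2 : (⌈x ^ 2⌉₊ : ℝ) < x ^ 2 + 1 := Nat.ceil_lt_add_one (by positivity)
  have hK1 : 3 * x * L ≤ ⌈3 * x * L⌉₊ := Nat.le_ceil _
  have hK2 : (⌈3 * x * L⌉₊ : ℝ) < 3 * x * L + 1 := Nat.ceil_lt_add_one (by positivity)
  -- With x = n^(1/3), this balances the flooding cost h ≈ x² against M² ≈ x² and M·K ≈ x² log n.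
  set h := ⌈x ^ 2⌉₊ with hh
  set K := ⌈3 * x * L⌉₊ with hK
  have hhn : h < n := by
    have : (h : ℝ) < n := by
      rw [← hx3]
      nlinarith
    exact_mod_cast this
  have hM : ((n / (h + 1) + 1 : ℕ) : ℝ) ≤ 2 * x := by
    have h1 : ((n / (h + 1) : ℕ) : ℝ) ≤ n / ((h + 1 : ℕ) : ℝ) := Nat.cast_div_le
    have h2 : (n : ℝ) / ((h + 1 : ℕ) : ℝ) ≤ x := by
      rw [div_le_iff₀ (by positivity), ← hx3]
      push_cast
      nlinarith
    push_cast at h1 h2 ⊢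
    linarith
  have hxL : 1 ≤ x * L := by nlinarith
  refine ⟨h, n / (h + 1) + 1, K, Nat.ceil_pos.2 (by positivity), hhn,
    Nat.lt_mul_of_div_lt (Nat.lt_succ_self _) h.succ_pos,
    sub_pow_mul_sq_lt_pow (by omega) hhn.le ?_, ?_⟩
  · calc 3 * (n : ℝ) * L = x ^ 2 * (3 * x * L) := by rw [← hx3]; ring
      _ ≤ h * K := by gcongr
  · rw [hx2]
    generalize n / (h + 1) + 1 = M at hM
    push_cast
    have hM0 : (0 : ℝ) ≤ M := Nat.cast_nonneg _
    have hK4 : (K : ℝ) ≤ 4 * (x * L) := by linarith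
    have hh4 : (h : ℝ) ≤ 2 * x ^ 2 := by nlinarith
    have hML : (M : ℝ) + K ≤ 6 * (x * L) := by nlinarith
    have hxx : x ≤ x ^ 2 := by nlinarith
    have hLL : L ≤ L ^ 2 := by nlinarith
    have hLL1 : 1 ≤ L ^ 2 := hL1.trans hLL
    calc 8 * (h : ℝ) + (M + K) * Nat.clog 2 n + M * M + M * K
        ≤ 8 * (2 * x ^ 2) + 6 * (x * L) * (3 * L) + 2 * x * (2 * x) + 2 * x * (4 * (x * L)) := by
          gcongr
      _ = 20 * (x ^ 2 * 1) + 18 * (x * L ^ 2) + 8 * (x ^ 2 * L) := by ring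
      _ ≤ 20 * (x ^ 2 * L ^ 2) + 18 * (x ^ 2 * L ^ 2) + 8 * (x ^ 2 * L ^ 2) := by gcongr
      _ = 46 * x ^ 2 * L ^ 2 := by ring

end Parameters

/-- The algorithm is deterministic: it makes no use of the seeds, and all global messages follow
collision-free schedules, so that the adversary has no influence. -/
theorem theorem2p2 :
    ∃ p : ℕ, ∀ a : ℕ, ∃ β : ℕ, ∀ g c : ℝ, 0 < g → 0 < c →
      ∃ (C : ℝ) (n₀ : ℕ), ∀ n : ℕ, n₀ ≤ n →
        ∃ (A : HybridAlgorithm n ⌈g * Real.log n⌉₊ (β * Nat.clog 2 n)) (T : ℕ),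
          (T : ℝ) ≤ C * (n : ℝ) ^ (2 / 3 : ℝ) * Real.log n ^ p ∧
          ∀ (G : SimpleGraph (Fin n)) (w : Sym2 (Fin n) → ℕ),
            G.Connected →
            (∀ e ∈ G.edgeSet, 1 ≤ w e ∧ w e ≤ n ^ a) →
            1 - (n : ℝ) ^ (-c) ≤ A.seedProb {r | A.SolvesAPSPWithSeeds T G w r} := by
  -- The exponent `4 * a + 8` makes room for a report, a triple of two nodes and a distance; `27 = 3
  -- ^ 3` ensures that the cube root of `n` is at least 3.
  refine ⟨2, fun a => ⟨4 * a + 8, fun g c hg _ => ⟨46, 27, fun n hn => ?_⟩⟩⟩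
  obtain ⟨h, M, K, hh, hhn, hM, hK, hT⟩ := exists_parameters hn
  have hγ : 0 < ⌈g * Real.log n⌉₊ :=
    Nat.ceil_pos.2 (mul_pos hg (Real.log_pos (by exact_mod_cast (by omega : 1 < n))))
  have hbits := pow_le_two_pow_mul_clog n (4 * a + 8)
  have hB : n ^ 3 + n < 2 ^ ((4 * a + 8) * Nat.clog 2 n) := by
    refine lt_of_lt_of_le ?_ ((Nat.pow_le_pow_right (by omega) (by omega : 4 ≤ 4 * a + 8)).trans hbits)
    nlinarith [Nat.le_self_pow (n := 3) (by norm_num) n, Nat.pow_le_pow_left hn 3]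
  obtain ⟨A, hA⟩ := (learns_weightedDist (W := n ^ a) hγ h M K hh hhn hM hK hB
    fun v hv s hs c hc => (pair_pair_lt (by omega) hv hs
      (hc.trans (Nat.mul_le_mul_right _ hhn.le))).trans_le hbits).exists_algorithm
  refine ⟨A, _, hT, fun G w hG hw => ?_⟩
  rw [hA G w hG fun e he => (hw e he).2]
  linarith [Real.rpow_nonneg (Nat.cast_nonneg (α := ℝ) n) (-c)]
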